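/- Linear orders are assumed to have as underlying set a subset of $\mathbb N$ (up to isomorphism, these are the countable linear orders). A (coded) predilator $D$ consists of a functor $D$ from the category of the finite orders $n=\{0,\dots,n-1\}$ (with order embeddings as morphisms) to the category of linear orders and order embeddings, such that $f\le g$ pointwise implies $D(f)\le D(g)$ pointwise, together with a natural family of functions $\operatorname{supp}_n:D(n)\to[n]^{<\omega}$ into the finite powersets such that, for every embedding $f:m\to n$, each $\tau\in D(n)$ with $\operatorname{supp}_n(\tau)\subseteq\operatorname{rng}(f)$ lies in $\operatorname{rng}(D(f))$. We also write $D$ for a subset of $\mathbb N$ that codes these data. For a linear order $\alpha$, let $\overline D(\alpha)$ be the set of pairs $(\sigma,a)$ with $a\subseteq\alpha$ finite, $\sigma\in D(|a|)$ and $\operatorname{supp}_{|a|}(\sigma)=|a|$, linearly ordered by $$(\sigma,a)\le(\tau,b)\iff D(|\iota_a|)(\sigma)\le D(|\iota_b|)(\tau),$$ where $|\iota_a|:|a|\to|a\cup b|$ and $|\iota_b|:|b|\to|a\cup b|$ are induced by the inclusions of $a$ and $b$ in $a\cup b$ via increasing enumerations. An embedding $f:\alpha\to\beta$ induces $\overline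 D(f):(\sigma,a)\mapsto(\sigma,f[a])$. One calls $D$ a dilator if $\overline D(\alpha)$ is well-founded for every well order $\alpha$. An $\omega$-model of $\mathsf{RCA}_0$ is a collection $\mathcal M$ of subsets of $\mathbb N$ that satisfies the axioms of $\mathsf{RCA}_0$ when number quantifiers range over $\mathbb N$ and set quantifiers over $\mathcal M$. We write $\mathsf{RCA}_0\vDash_\omega$ "$D$ is a dilator" if there is a $Y\subseteq\mathbb N$ such that $\mathcal M\vDash$ "$D$ is a dilator" holds for every $\omega$-model $\mathcal M\vDash\mathsf{RCA}_0$ with $D,Y\in\mathcal M$. For a linear order $L=(\mathbb N,\le_L)$ and $n\in\mathbb N$, let $\pi^L_n$ be the permutation of $\{0,\dots,n-1\}$ with $\pi^L_n(i)\le\pi^L_n(j)\Leftrightarrow i\le_L j$. For a linear order $\alpha$, let $D_L(\alpha)$ be the set of finite strictly increasing sequences $\sigma=\langle\sigma(0),\dots,\sigma(l(\sigma)-1)\rangle$ in $\alpha$. With $\sigma^L_i=\sigma(\pi^L_{l(\sigma)}(i))$, we order $D_L(\alpha)$ by declaring $\sigma<\tau$ if either there is $j<\min(l(\sigma),l(\tau))$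 with $\sigma^L_j<\tau^L_j$ and $\sigma^L_i=\tau^L_i$ for all $i<j$, or $l(\sigma)<l(\tau)$ and $\sigma^L_i=\tau^L_i$ for all $i<l(\sigma)$. For an embedding $f$, let $D_L(f)$ apply $f$ entrywise. The order $\omega\cdot(1+\alpha)$ consists of elements $\omega\cdot x+n$ with $x\in1+\alpha$ and $n\in\mathbb N$, compared lexicographically with $x$ taking precedence; here $1+\alpha$ is $\alpha$ with a new least element $0$. An embedding $f:\alpha\to\beta$ induces the embedding $\omega\cdot(1+f)$ that acts as $f$ on elements of $\alpha$ and fixes $0$ and all $n$. Such an $L$ is called a thread of $D$ if there are order embeddings $\eta_\alpha:D_L(\alpha)\to\overline D(\omega\cdot(1+\alpha))$ for all linear orders $\alpha$, with $\eta_\beta\circ D_L(f)=\overline D(\omega\cdot(1+f))\circ\eta_\alpha$ for every embedding $f:\alpha\to\beta$. **Theorem.** Let $D$ be a predilator such that $\overline D(\omega^2)$ is well-founded. Then at least one of the following holds: (i) $\mathsf{RCA}_0\vDash_\omega$ "$D$ is a dilator"; (ii) $D$ has a thread. -/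

import Mathlib

namespace DilatorDichotomy

/-! ### Countable linear orders -/

/-- A linear order whose underlying set is a subset of `ℕ`, given as in second-order arithmetic by
a reflexive relation on `ℕ`; the underlying set is the field `{x | x ≤ x}` of that relation. -/
structure LO where
  rel : ℕ → ℕ → Prop
  field : ∀ x y, rel x y → rel x x ∧ rel y y
  trans : ∀ x y z, rel x y → rel y z → rel x z
  antisymm : ∀ x y, rel x y → rel y x → x = y
  total : ∀ x y, rel x x → rel y y → rel x y ∨ rel y x

/-- The type of elements of a linear order. It carries the order `rel`, not that of `ℕ`. -/
def LO.Elem (α : LO) : Type := {x : ℕ // α.rel x x}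

instance : CoeSort LO Type := ⟨LO.Elem⟩

/-- The natural number that an element is. -/
def LO.toNat {α : LO} (x : α) : ℕ := x.1

noncomputable instance (α : LO) : LinearOrder α where
  le x y := α.rel x.1 y.1
  le_refl x := x.2
  le_trans x y z := α.trans x.1 y.1 z.1
  le_antisymm x y h h' := Subtype.ext (α.antisymm x.1 y.1 h h')
  le_total x y := α.total x.1 y.1 x.2 y.2
  toDecidableLE := Classical.decRel _

/-- The subset of `ℕ` that represents a linear order. -/
def LO.code (α : LO) : Set ℕ := {k | ∃ x y, α.rel x y ∧ k = Nat.pair x y}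

/-! ### Predilators -/

/-- A (coded) predilator: a monotone functor from the category of the finite orders
`n = {0, …, n-1}` and embeddings to the category of countable linear orders and embeddings, with a
natural transformation to the finite powerset functor that satisfies the support condition. -/
structure Predilator where
  obj : ℕ → LO
  map : ∀ {m n : ℕ}, (Fin m ↪o Fin n) → (obj m ↪o obj n)
  map_id : ∀ {n : ℕ} (σ : obj n), map (RelEmbedding.refl _) σ = σ
  map_comp : ∀ {l m n : ℕ} (f : Fin l ↪o Fin m) (g : Fin m ↪o Fin n) (σ : obj l),
    map (f.trans g) σ = map g (map f σ)
  map_mono : ∀ {m n : ℕ} (f g : Fin m ↪o Fin n), (∀ i, f i ≤ g i) →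
    ∀ σ : obj m, map f σ ≤ map g σ
  supp : ∀ n : ℕ, obj n → Finset (Fin n)
  supp_map : ∀ {m n : ℕ} (f : Fin m ↪o Fin n) (σ : obj m),
    supp n (map f σ) = (supp m σ).map f.toEmbedding
  supp_cond : ∀ {m n : ℕ} (f : Fin m ↪o Fin n) (τ : obj n),
    (∀ i ∈ supp n τ, i ∈ Set.range f) → τ ∈ Set.range (map f)

/-- The code of a finite set of natural numbers: the code of its increasing enumeration. -/
def codeFinset (a : Finset ℕ) : ℕ := Encodable.encode (a.sort (· ≤ ·))

/-- The subset of `ℕ` that represents a predilator. It is the disjoint union of the graphs of the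
orders `D(n)`, of the embeddings `D(f)` and of the support functions. An embedding `f : m → n` is
given by the number `n` and the sequence of its values. -/
def Predilator.code (D : Predilator) : Set ℕ :=
  {k | ∃ (n : ℕ) (σ τ : D.obj n), σ ≤ τ ∧
      k = Nat.pair 0 (Nat.pair n (Nat.pair (LO.toNat σ) (LO.toNat τ)))} ∪
  {k | ∃ (m n : ℕ) (f : Fin m ↪o Fin n) (σ : D.obj m),
      k = Nat.pair 1 (Nat.pair n (Nat.pair (Encodable.encode (List.ofFn fun i => (f i : ℕ)))
        (Nat.pair (LO.toNat σ) (LO.toNat (D.map f σ)))))} ∪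
  {k | ∃ (n : ℕ) (σ : D.obj n),
      k = Nat.pair 2 (Nat.pair n (Nat.pair (LO.toNat σ)
        (codeFinset ((D.supp n σ).map Fin.valEmbedding))))}

/-! ### Extension of a predilator to arbitrary linear orders -/

/-- The elements `(σ, a)` of the extended predilator at `α`: a finite `a ⊆ α` with `n` elements,
and `σ ∈ D(n)` with full support `n = {0, …, n-1}`. -/
structure Ext (D : Predilator) (α : Type*) where
  n : ℕ
  a : Finset α
  card : a.card = n
  σ : D.obj n
  full : D.supp n σ = Finset.univ

/-- For finite `a ⊆ c`, the embedding `m → n` of the cardinalities that is induced by the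
inclusion of `a` in `c` via the increasing enumerations of these sets. -/
noncomputable def inclFin {α : Type*} [LinearOrder α] {a c : Finset α} {m n : ℕ}
    (ha : a.card = m) (hc : c.card = n) (h : a ⊆ c) : Fin m ↪o Fin n :=
  OrderEmbedding.ofStrictMono
    (fun i => (c.orderIsoOfFin hc).symm
      ⟨(a.orderIsoOfFin ha i : α), h (a.orderIsoOfFin ha i).2⟩)
    (fun _ _ hij => (c.orderIsoOfFin hc).symm.strictMono ((a.orderIsoOfFin ha).strictMono hij))

/-- The order on the extended predilator: `(σ, a) ≤ (τ, b)` if and only if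
`D(|ι_a|)(σ) ≤ D(|ι_b|)(τ)` for the inclusions of `a` and `b` in `a ∪ b`. -/
instance {D : Predilator} {α : Type*} [LinearOrder α] : LE (Ext D α) where
  le x y := D.map (inclFin x.card rfl (Finset.subset_union_left (s₂ := y.a))) x.σ ≤
    D.map (inclFin y.card rfl (Finset.subset_union_right (s₁ := x.a))) y.σ

instance {D : Predilator} {α : Type*} [LinearOrder α] : LT (Ext D α) where
  lt x y := x ≤ y ∧ ¬ y ≤ x

/-- The action on embeddings: `(σ, a)` is mapped to `(σ, f[a])`. -/
def Ext.map {D : Predilator} {α β : Type*} [LinearOrder α] [LinearOrder β] (f : α ↪o β)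
    (x : Ext D α) : Ext D β where
  n := x.n
  a := x.a.map f.toEmbedding
  card := by rw [Finset.card_map, x.card]
  σ := x.σ
  full := x.full

/-- The natural number that represents an element `(σ, a)` when `α` is a subset of `ℕ`. -/
def Ext.code {D : Predilator} {α : LO} (x : Ext D α) : ℕ :=
  Nat.pair (LO.toNat x.σ) (codeFinset (x.a.map ⟨LO.toNat, Subtype.val_injective⟩))

/-! ### `ω`-models of `RCA₀` -/

/-- Number terms of second-order arithmetic (with de Bruijn indices). -/
inductive Tm where
  | var : ℕ → Tm
  | zero : Tm
  | one : Tm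
  | add : Tm → Tm → Tm
  | mul : Tm → Tm → Tm

/-- Bounded (that is, `Δ⁰₀`) formulas of second-order arithmetic, with free number and set
variables. The bounded quantifiers bind the number variable with index `0`; the bounding term is
outside of their scope. -/
inductive Bdd where
  | eq : Tm → Tm → Bdd
  | lt : Tm → Tm → Bdd
  | mem : Tm → ℕ → Bdd
  | neg : Bdd → Bdd
  | and : Bdd → Bdd → Bdd
  | or : Bdd → Bdd → Bdd
  | ball : Tm → Bdd → Bdd
  | bex : Tm → Bdd → Bdd

/-- The assignment with value `x` at index `0` and the values of `v` at the later indices. -/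
def push (x : ℕ) (v : ℕ → ℕ) : ℕ → ℕ
  | 0 => x
  | i + 1 => v i

def Tm.val (v : ℕ → ℕ) : Tm → ℕ
  | var i => v i
  | zero => 0
  | one => 1
  | add s t => s.val v + t.val v
  | mul s t => s.val v * t.val v

/-- Satisfaction of a bounded formula under an assignment `S` of sets and `v` of numbers. -/
def Bdd.Sat (S : ℕ → Set ℕ) : (ℕ → ℕ) → Bdd → Prop
  | v, eq s t => s.val v = t.val v
  | v, lt s t => s.val v < t.val v
  | v, mem t i => t.val v ∈ S i
  | v, neg φ => ¬ φ.Sat S v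
  | v, and φ ψ => φ.Sat S v ∧ ψ.Sat S v
  | v, or φ ψ => φ.Sat S v ∨ ψ.Sat S v
  | v, ball t φ => ∀ x < t.val v, φ.Sat S (push x v)
  | v, bex t φ => ∃ x < t.val v, φ.Sat S (push x v)

/-- The `ω`-model with the collection `M` of sets satisfies `RCA₀`, i.e. induction for
`Σ⁰₁`-formulas and comprehension for `Δ⁰₁`-formulas, in both cases with number parameters and with
set parameters from `M`. (The remaining axioms concern the standard natural numbers only and hold
in any `ω`-model. Since the numbers are standard, induction does also hold automatically.) -/
structure IsOmegaModelRCA0 (M : Set (Set ℕ)) : Prop where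
  nonempty : M.Nonempty
  induction : ∀ (θ : Bdd) (S : ℕ → Set ℕ) (v : ℕ → ℕ), (∀ i, S i ∈ M) →
    (∃ x, θ.Sat S (push x (push 0 v))) →
    (∀ n, (∃ x, θ.Sat S (push x (push n v))) → ∃ x, θ.Sat S (push x (push (n + 1) v))) →
    ∀ n, ∃ x, θ.Sat S (push x (push n v))
  comprehension : ∀ (θ ψ : Bdd) (S : ℕ → Set ℕ) (v : ℕ → ℕ), (∀ i, S i ∈ M) →
    (∀ n, (∃ x, θ.Sat S (push x (push n v))) ↔ (∀ x, ψ.Sat S (push x (push n v)))) →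
    {n | ∃ x, θ.Sat S (push x (push n v))} ∈ M

/-- The entailment `RCA₀ ⊨_ω φ(X)` on a cone of `ω`-models. Here `φ` is given by its truth value in
each `ω`-model, where number quantifiers range over `ℕ` and set quantifiers range over `M`. -/
def RCA0OmegaEntails (X : Set ℕ) (φ : Set (Set ℕ) → Prop) : Prop :=
  ∃ Y : Set ℕ, ∀ M : Set (Set ℕ), IsOmegaModelRCA0 M → X ∈ M → Y ∈ M → φ M

/-- The order `lt` on `A`, with elements represented by numbers, is well-founded according to the
`ω`-model `M`, i.e. (the graph of) an infinite descending sequence is never in `M`. -/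
def WellFoundedIn (M : Set (Set ℕ)) {A : Type} (lt : A → A → Prop) (code : A → ℕ) : Prop :=
  ¬ ∃ f : ℕ → A, (∀ i, lt (f (i + 1)) (f i)) ∧ {k | ∃ i, k = Nat.pair i (code (f i))} ∈ M

/-- The statement "`D` is a dilator", evaluated in the `ω`-model `M`: the extension of `D` maps any
linear order in `M` that is well-founded according to `M` to an order that is well-founded
according to `M`. (That `D` is a predilator is an arithmetical property, hence it holds in `M`.) -/
def IsDilatorIn (D : Predilator) (M : Set (Set ℕ)) : Prop :=
  ∀ α : LO, α.code ∈ M →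
    WellFoundedIn M (fun x y : α => x < y) LO.toNat →
    WellFoundedIn M (fun x y : Ext D α => x < y) Ext.code

/-! ### Threads -/

open Classical in
/-- The number of elements of `n = {0, …, n-1}` that lie strictly below `i` with respect to `L`. -/
noncomputable def perm (L : LO) (n : ℕ) (i : Fin n) : Fin n :=
  ⟨(Finset.univ.filter fun j : Fin n => L.rel j i ∧ ¬ L.rel i j).card, by
    have h : (Finset.univ.filter fun j : Fin n => L.rel j i ∧ ¬ L.rel i j) ⊂ Finset.univ :=
      Finset.filter_ssubset.2 ⟨i, Finset.mem_univ _, fun h => h.2 h.1⟩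
    simpa using Finset.card_lt_card h⟩

/-- If `L` has underlying set `ℕ`, then `perm L n` is the permutation of `n` that is determined by
this equivalence. -/
theorem perm_le_perm_iff (L : LO) (hL : ∀ k, L.rel k k) (n : ℕ) (i j : Fin n) :
    perm L n i ≤ perm L n j ↔ L.rel i j := by
  classical
  have tr := L.trans
  have key : ∀ i j : Fin n, L.rel i j → perm L n i ≤ perm L n j := fun i j h => by
    simp only [perm, Fin.mk_le_mk]
    refine Finset.card_le_card fun k hk => ?_
    simp only [Finset.mem_filter, Finset.mem_univ, true_and] at hk ⊢
    exact ⟨tr _ _ _ hk.1 h, fun h' => hk.2 (tr _ _ _ h h')⟩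
  refine ⟨fun h => ?_, key i j⟩
  by_contra hn
  have hlt : L.rel j i := (L.total j i (hL _) (hL _)).resolve_right hn
  refine absurd h (not_le.2 ?_)
  simp only [perm, Fin.mk_lt_mk]
  refine Finset.card_lt_card ((Finset.ssubset_iff_of_subset ?_).2 ⟨j, ?_, ?_⟩)
  · intro k hk
    simp only [Finset.mem_filter, Finset.mem_univ, true_and] at hk ⊢
    exact ⟨tr _ _ _ hk.1 hlt, fun h' => hk.2 (tr _ _ _ hlt h')⟩
  · simpa using ⟨hlt, hn⟩
  · simp

/-- The underlying set of `D_L(α)`: the finite increasing sequences in `α`. -/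
structure DL (L : LO) (α : Type*) [LinearOrder α] where
  len : ℕ
  seq : Fin len ↪o α

/-- The entry `σ^L_i = σ(π^L(i))`. -/
noncomputable def DL.arg {L : LO} {α : Type*} [LinearOrder α] (σ : DL L α)
    (i : Fin σ.len) : α :=
  σ.seq (perm L σ.len i)

/-- The permuted lexicographic order on `D_L(α)`. -/
instance {L : LO} {α : Type*} [LinearOrder α] : LT (DL L α) where
  lt σ τ :=
    (∃ (j : ℕ) (hσ : j < σ.len) (hτ : j < τ.len), σ.arg ⟨j, hσ⟩ < τ.arg ⟨j, hτ⟩ ∧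
      ∀ (i : ℕ) (hi : i < j), σ.arg ⟨i, hi.trans hσ⟩ = τ.arg ⟨i, hi.trans hτ⟩) ∨
    (∃ h : σ.len < τ.len, ∀ (i : ℕ) (hi : i < σ.len), σ.arg ⟨i, hi⟩ = τ.arg ⟨i, hi.trans h⟩)

/-- The action of `D_L` on embeddings. -/
def DL.map {L : LO} {α β : Type*} [LinearOrder α] [LinearOrder β] (f : α ↪o β)
    (σ : DL L α) : DL L β where
  len := σ.len
  seq := σ.seq.trans f

/-- The order `ω · (1 + α)`: the pair of `⊥` and `n` is `ω · 0 + n`, and the pair of `x` and `n` is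
`ω · (1 + x) + n`. -/
def OmegaMul (α : Type*) : Type _ := WithBot α ×ₗ ℕ

noncomputable instance {α : Type*} [LinearOrder α] : LinearOrder (OmegaMul α) :=
  inferInstanceAs (LinearOrder (WithBot α ×ₗ ℕ))

/-- The embedding `ω · (1 + f)`. -/
noncomputable def OmegaMul.map {α β : Type*} [LinearOrder α] [LinearOrder β] (f : α ↪o β) :
    OmegaMul α ↪o OmegaMul β :=
  OrderEmbedding.ofStrictMono
    (fun p : WithBot α ×ₗ ℕ => (toLex (WithBot.map f (ofLex p).1, (ofLex p).2) : WithBot β ×ₗ ℕ))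
    (by
      intro p q h
      refine (Prod.Lex.lt_iff (α := WithBot β) (β := ℕ)).2 ?_
      rcases (Prod.Lex.lt_iff (α := WithBot α) (β := ℕ)).1 h with h | ⟨h, h'⟩
      · exact Or.inl (f.strictMono.withBot_map h)
      · exact Or.inr ⟨congrArg (WithBot.map f) h, h'⟩)

/-- The linear order `L` is a thread of `D`: its underlying set is `ℕ`, and there is a natural family of embeddings
`D_L(α) → D(ω · (1 + α))`, where `α` ranges over the countable linear orders. -/
def IsThread (L : LO) (D : Predilator) : Prop :=
  (∀ n, L.rel n n) ∧ ∃ η : ∀ α : LO, DL L α → Ext D (OmegaMul α),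
    (∀ (α : LO) (ρ τ : DL L α), ρ < τ ↔ η α ρ < η α τ) ∧
    ∀ (α β : LO) (f : α ↪o β) (ρ : DL L α),
      η β (ρ.map f) = (η α ρ).map (OmegaMul.map f)

end DilatorDichotomy

namespace DilatorDichotomy

-- An element of the extended predilator is a trace `s` applied to finitely many arguments. For each
-- trace, the arguments can be ranked by importance: if two applications agree on the most important
-- arguments, the next one decides which is larger (`exists_priority`). Two different traces are
-- then compared level by level. If they share their `q` most important arguments, then either the
-- order between them does not depend on the remaining arguments, or the next arguments lie in the
-- same interval of the shared ones and again decide (`tieComparable_of_not_const`,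
-- `TieComparable`).
--
-- If (i) fails, then for any choice of `Y` some `ω`-model containing `Y` has a linear order `α`,
-- well-founded in the model, and a descending sequence `f` in the extension at `α`. Once the
-- sequence of arguments of importance `q` is defined from some stage on, it reaches a minimum:
-- otherwise `f` and `α` would compute a descending sequence in `α` relative to `Y`. The set `Y` has
-- to be fixed before the model. This is possible since the computation is a continuous functional
-- with a single code (`exists_table`, `exists_stabilizing_set`).
--
-- Well-foundedness at `ω²` yields comparability (`exists_stable`). When the first `q` arguments
-- have become constant, they are moved to fixed limit points of `ω²`, with the other arguments
-- placed just above them. At an element with minimal image, the later elements are smaller in the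
-- original order but have no smaller image. So the remaining arguments do matter, and argument `q`
-- decides. It cannot increase, because `f` descends; after its minimum it is constant.
--
-- In the limit there are infinitely many stable arguments, and their order is the thread `L`. A
-- sequence of length `l` is mapped to a sufficiently late trace of `f`, with the entries as its `l`
-- most important arguments and the other arguments filled in naturally (`exists_isThread`).

variable {D : Predilator} {α β : Type*} [LinearOrder α] [LinearOrder β]

/-! ### Traces, arguments and the linear order on the extended predilator -/

/-- An element of the trace of a predilator: an element of `D(n)` with full support. -/
structure Tr (D : Predilator) where
  n : ℕ
  σ : D.obj n
  full : D.supp n σ = Finset.univ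

/-- The element of the extended predilator that is given by a trace and an increasing sequence of
arguments. -/
def Tr.app (s : Tr D) (a : Fin s.n ↪o α) : Ext D α :=
  ⟨s.n, Finset.univ.map a.toEmbedding, by simp, s.σ, s.full⟩

def Ext.tr (x : Ext D α) : Tr D := ⟨x.n, x.σ, x.full⟩

/-- The increasing sequence of arguments. -/
noncomputable def Ext.enum (x : Ext D α) : Fin x.n ↪o α := x.a.orderEmbOfFin x.card

theorem Ext.app_tr_enum (x : Ext D α) : x.tr.app x.enum = x := by
  obtain ⟨n, a, card, σ, full⟩ := x
  simp only [Tr.app, Ext.tr, Ext.enum, Ext.mk.injEq, heq_eq_eq, and_true, true_and]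
  ext i
  have := Finset.range_orderEmbOfFin a card
  rw [← Finset.mem_coe (s := a), ← this, Finset.mem_map]
  exact ⟨fun ⟨j, _, h⟩ => ⟨j, h⟩, fun ⟨j, h⟩ => ⟨j, Finset.mem_univ _, h⟩⟩

theorem enum_app (s : Tr D) (a : Fin s.n ↪o α) :
    (s.app a).enum = a := by
  refine DFunLike.coe_injective ?_
  refine (Finset.orderEmbOfFin_unique (s.app a).card (f := a) (fun i => ?_) a.strictMono).symm
  exact Finset.mem_map_of_mem _ (Finset.mem_univ _)

theorem inclFin_trans {a c : Finset α} {m n : ℕ} (ha : a.card = m) (hc : c.card = n) (h : a ⊆ c) :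
    (inclFin ha hc h).trans (c.orderEmbOfFin hc) = a.orderEmbOfFin ha := by
  ext i
  simp only [inclFin, RelEmbedding.coe_trans, Function.comp_apply]
  rw [← Finset.coe_orderIsoOfFin_apply]
  simp

/-- An embedding whose range is contained in the range of another one factors through it. -/
theorem exists_factor {k N : ℕ} (c : Fin k ↪o α) (e : Fin N ↪o α)
    (h : ∀ i, c i ∈ Set.range e) : ∃ g : Fin k ↪o Fin N, g.trans e = c := by
  choose g hg using h
  refine ⟨OrderEmbedding.ofMapLEIff g fun i j => ?_, ?_⟩
  · rw [← e.le_iff_le, hg, hg, c.le_iff_le]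
  · ext i; simp [hg]

/-- The union of the two supports, used in the definition of the order, embeds into any common
finite index set, and `D` maps this embedding to one that reflects the order. Hence any common index
set will do for comparisons. -/
theorem app_trans_le_iff (s t : Tr D) {N : ℕ} (e : Fin N ↪o α) (f : Fin s.n ↪o Fin N)
    (g : Fin t.n ↪o Fin N) :
    s.app (f.trans e) ≤ t.app (g.trans e) ↔ D.map f s.σ ≤ D.map g t.σ := by
  set x := s.app (f.trans e) with hx
  set y := t.app (g.trans e) with hy
  obtain ⟨h, hh⟩ := exists_factor ((x.a ∪ y.a).orderEmbOfFin rfl) e (fun i => by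
    have := Finset.orderEmbOfFin_mem (x.a ∪ y.a) rfl i
    simp only [hx, hy, Tr.app, Finset.mem_union, Finset.mem_map, Finset.mem_univ, true_and] at this
    rcases this with ⟨j, hj⟩ | ⟨j, hj⟩
    · exact ⟨f j, hj⟩
    · exact ⟨g j, hj⟩)
  have hf : (inclFin x.card rfl (Finset.subset_union_left (s₂ := y.a))).trans h = f := by
    refine DFunLike.ext _ _ fun i => e.injective ?_
    have h1 := DFunLike.congr_fun
      (inclFin_trans x.card rfl (Finset.subset_union_left (s₂ := y.a))) i
    have h2 := DFunLike.congr_fun (enum_app s (f.trans e)) i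
    rw [← hh] at h1
    exact h1.trans h2
  have hg : (inclFin y.card rfl (Finset.subset_union_right (s₁ := x.a))).trans h = g := by
    refine DFunLike.ext _ _ fun i => e.injective ?_
    have h1 := DFunLike.congr_fun
      (inclFin_trans y.card rfl (Finset.subset_union_right (s₁ := x.a))) i
    have h2 := DFunLike.congr_fun (enum_app t (g.trans e)) i
    rw [← hh] at h1
    exact h1.trans h2
  have ef : D.map f s.σ = D.map h (D.map (inclFin x.card rfl Finset.subset_union_left) x.σ) :=
    (congrArg (fun k => D.map k s.σ) hf.symm).trans (D.map_comp _ _ _)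
  have eg : D.map g t.σ = D.map h (D.map (inclFin y.card rfl Finset.subset_union_right) y.σ) :=
    (congrArg (fun k => D.map k t.σ) hg.symm).trans (D.map_comp _ _ _)
  rw [ef, eg, (D.map h).le_iff_le]
  rfl

theorem exists_common (l : List (Σ n, Fin n ↪o α)) :
    ∃ (N : ℕ) (e : Fin N ↪o α), ∀ a ∈ l, ∃ f : Fin a.1 ↪o Fin N, f.trans e = a.2 := by
  classical
  let c : Finset α := l.toFinset.biUnion fun a => Finset.univ.map a.2.toEmbedding
  refine ⟨c.card, c.orderEmbOfFin rfl, fun a ha => exists_factor _ _ fun i => ?_⟩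
  rw [Finset.range_orderEmbOfFin, Finset.mem_coe, Finset.mem_biUnion]
  exact ⟨a, by simpa using ha, by simp⟩

theorem exists_common_two {m n : ℕ} (a : Fin m ↪o α) (b : Fin n ↪o α) :
    ∃ (N : ℕ) (e : Fin N ↪o α) (f : Fin m ↪o Fin N) (g : Fin n ↪o Fin N),
      f.trans e = a ∧ g.trans e = b := by
  obtain ⟨N, e, h⟩ := exists_common [⟨m, a⟩, ⟨n, b⟩]
  obtain ⟨f, hf⟩ := h ⟨m, a⟩ (by simp)
  obtain ⟨g, hg⟩ := h ⟨n, b⟩ (by simp)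
  exact ⟨N, e, f, g, hf, hg⟩

theorem app_map (s : Tr D) (a : Fin s.n ↪o α) (φ : α ↪o β) :
    (s.app a).map φ = s.app (a.trans φ) := by
  simp only [Tr.app, Ext.map, Ext.mk.injEq, heq_eq_eq, and_true, true_and, Finset.map_map]
  rfl

theorem app_trans_le (s t : Tr D) (a : Fin s.n ↪o α) (b : Fin t.n ↪o α) (φ : α ↪o β) :
    s.app (a.trans φ) ≤ t.app (b.trans φ) ↔ s.app a ≤ t.app b := by
  obtain ⟨N, e, f, g, rfl, rfl⟩ := exists_common_two a b
  rw [app_trans_le_iff, ← app_trans_le_iff s t (e.trans φ)]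
  rfl

theorem app_trans_lt (s t : Tr D) (a : Fin s.n ↪o α) (b : Fin t.n ↪o α) (φ : α ↪o β) :
    s.app (a.trans φ) < t.app (b.trans φ) ↔ s.app a < t.app b := by
  simp only [LT.lt, app_trans_le]

theorem Ext.induction {p : Ext D α → Prop} (h : ∀ (s : Tr D) (a : Fin s.n ↪o α), p (s.app a))
    (x : Ext D α) : p x := by
  rw [← x.app_tr_enum]; exact h _ _

/-- By naturality, the support of the common image is the range of both `f` and `g`, so these
coincide; then injectivity of `D.map f` identifies the traces. This gives antisymmetry of the order.
-/
theorem Tr.eq_of_map_eq (s t : Tr D) {N : ℕ} (f : Fin s.n ↪o Fin N) (g : Fin t.n ↪o Fin N)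
    (h : D.map f s.σ = D.map g t.σ) (e : Fin N ↪o α) :
    s.app (f.trans e) = t.app (g.trans e) := by
  obtain ⟨n, σ, hσ⟩ := s
  obtain ⟨m, τ, hτ⟩ := t
  dsimp only at f g h ⊢
  have hs := congrArg (D.supp N) h
  rw [D.supp_map, D.supp_map, hσ, hτ] at hs
  have hc : n = m := by simpa using congrArg Finset.card hs
  subst hc
  have hfg : f = g := by
    refine DFunLike.coe_injective ((StrictMono.range_inj f.strictMono g.strictMono).1 ?_)
    have := congrArg (fun s : Finset (Fin N) => (s : Set (Fin N))) hs
    simpa using this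
  subst hfg
  have : σ = τ := (D.map f).injective h
  subst this
  rfl

noncomputable instance : LinearOrder (Ext D α) where
  le := (· ≤ ·)
  lt := (· < ·)
  le_refl := Ext.induction fun s a => by
    have := app_trans_le_iff s s a (RelEmbedding.refl _) (RelEmbedding.refl _)
    exact this.2 le_rfl
  le_trans := Ext.induction fun s a => Ext.induction fun t b => Ext.induction fun u c => by
    obtain ⟨N, e, h⟩ := exists_common [⟨_, a⟩, ⟨_, b⟩, ⟨_, c⟩]
    obtain ⟨f, hf⟩ := h ⟨_, a⟩ (by simp)
    obtain ⟨g, hg⟩ := h ⟨_, b⟩ (by simp)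
    obtain ⟨k, hk⟩ := h ⟨_, c⟩ (by simp)
    dsimp only at f g k hf hg hk
    rw [← hf, ← hg, ← hk, app_trans_le_iff, app_trans_le_iff, app_trans_le_iff]
    exact le_trans
  le_antisymm := Ext.induction fun s a => Ext.induction fun t b => by
    obtain ⟨N, e, f, g, rfl, rfl⟩ := exists_common_two a b
    rw [app_trans_le_iff, app_trans_le_iff]
    exact fun h h' => Tr.eq_of_map_eq _ _ _ _ (le_antisymm h h') _
  le_total := Ext.induction fun s a => Ext.induction fun t b => by
    obtain ⟨N, e, f, g, rfl, rfl⟩ := exists_common_two a b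
    rw [app_trans_le_iff, app_trans_le_iff]
    exact le_total _ _
  lt_iff_le_not_ge _ _ := Iff.rfl
  toDecidableLE := Classical.decRel _

theorem Tr.app_injective (s : Tr D) : Function.Injective (s.app : (Fin s.n ↪o α) → Ext D α) := by
  intro a b h
  have h1 : Finset.univ.map a.toEmbedding = Finset.univ.map b.toEmbedding := by
    simpa [Tr.app] using h
  refine DFunLike.coe_injective ((StrictMono.range_inj a.strictMono b.strictMono).1 ?_)
  have := congrArg (fun s : Finset α => (s : Set α)) h1
  simpa using this

theorem Tr.app_mono (s : Tr D) {a b : Fin s.n ↪o α} (h : ∀ i, a i ≤ b i) : s.app a ≤ s.app b := by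
  obtain ⟨N, e, f, g, rfl, rfl⟩ := exists_common_two a b
  rw [app_trans_le_iff]
  exact D.map_mono _ _ (fun i => e.le_iff_le.1 (h i)) _

theorem Tr.app_lt (s : Tr D) {a b : Fin s.n ↪o α} (h : ∀ i, a i ≤ b i) (i : Fin s.n)
    (hi : a i < b i) : s.app a < s.app b :=
  lt_of_le_of_ne (s.app_mono h) fun e => hi.ne (by rw [s.app_injective e])

/-! ### Order patterns of rational arguments -/

/-- A finite partial order isomorphism of the rationals extends to an embedding. -/
theorem exists_strictMono_eqOn (P : Finset ℚ) (g : ℚ → ℚ) (hg : StrictMonoOn g P) :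
    ∃ φ : ℚ → ℚ, StrictMono φ ∧ ∀ x ∈ P, φ x = g x := by
  induction P using Finset.induction_on_max with
  | empty => exact ⟨id, strictMono_id, by simp⟩
  | insert m P hm ih =>
    obtain ⟨φ, hφ, hP⟩ := ih (hg.mono (by simp))
    rcases P.eq_empty_or_nonempty with rfl | hne
    · refine ⟨fun x => x - m + g m, fun x y h => by simpa using h, by simp⟩
    · set p := P.max' hne
      have hp : p ∈ P := P.max'_mem hne
      have hpm : p < m := hm p hp
      have hgp : φ p < g m := by
        rw [hP p hp]; exact hg (by simp [hp]) (by simp) hpm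
      have hsl : 0 < (g m - φ p) / (m - p) := div_pos (by linarith) (by linarith)
      -- Up to the previous maximum `p` the map is kept; beyond, it follows the line through `(p, φ
      -- p)` and `(m, g m)`.
      refine ⟨fun x => if x ≤ p then φ x else φ p + (x - p) * ((g m - φ p) / (m - p)), ?_, ?_⟩
      · intro x y hxy
        dsimp only
        split_ifs with h1 h2 h2
        · exact hφ hxy
        · have := hφ.monotone h1
          have := mul_pos (sub_pos.2 (not_le.1 h2)) hsl
          linarith
        · exact absurd (hxy.le.trans h2) h1
        · have := mul_lt_mul_of_pos_right (sub_lt_sub_right hxy p) hsl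
          linarith
      · intro x hx
        rcases Finset.mem_insert.1 hx with rfl | hx
        · dsimp only
          rw [if_neg (not_le.2 hpm), mul_div_cancel₀ _ (by linarith [hpm] : x - p ≠ 0)]
          ring
        · dsimp only
          rw [if_pos (P.le_max' x hx), hP x hx]

theorem exists_embedding_extending {ι : Type*} [Finite ι] (w w' : ι → ℚ)
    (h : ∀ i j, w i < w j ↔ w' i < w' j) : ∃ φ : ℚ ↪o ℚ, ∀ i, φ (w i) = w' i := by
  classical
  cases nonempty_fintype ι
  have hf : w'.FactorsThrough w := fun i j hij => by
    refine le_antisymm (not_lt.1 fun hl => ?_) (not_lt.1 fun hl => ?_) <;>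
    · rw [← h, hij] at hl
      exact lt_irrefl _ hl
  obtain ⟨φ, hφ, hP⟩ := exists_strictMono_eqOn (Finset.univ.image w) (Function.extend w w' 0) (by
    intro x hx y hy hxy
    simp only [Finset.coe_image, Finset.coe_univ, Set.image_univ, Set.mem_range] at hx hy
    obtain ⟨i, rfl⟩ := hx
    obtain ⟨j, rfl⟩ := hy
    rw [hf.extend_apply, hf.extend_apply]
    exact (h i j).1 hxy)
  refine ⟨OrderEmbedding.ofStrictMono φ hφ, fun i => ?_⟩
  rw [OrderEmbedding.coe_ofStrictMono, hP _ (by simp), hf.extend_apply]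

/-- The order of the extended predilator depends on the order pattern of the arguments only. -/
theorem app_lt_congr (s t : Tr D) (a a' : Fin s.n ↪o ℚ) (b b' : Fin t.n ↪o ℚ)
    (h : ∀ i j, a i < b j ↔ a' i < b' j) (h' : ∀ i j, b j < a i ↔ b' j < a' i) :
    s.app a < t.app b ↔ s.app a' < t.app b' := by
  obtain ⟨φ, hφ⟩ := exists_embedding_extending (Sum.elim a b) (Sum.elim a' b') (by
    rintro (i | i) (j | j)
    · simp
    · exact h i j
    · exact h' j i
    · simp)
  have ha : a.trans φ = a' := DFunLike.ext _ _ fun i => hφ (.inl i)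
  have hb : b.trans φ = b' := DFunLike.ext _ _ fun i => hφ (.inr i)
  rw [← ha, ← hb, app_trans_lt]

theorem exists_pos_lt {ι : Type*} [Finite ι] (d : ι → ℚ) (hd : ∀ i, 0 < d i) :
    ∃ ε > 0, ∀ i, ε < d i := by
  rcases isEmpty_or_nonempty ι with h | h
  · exact ⟨1, one_pos, fun i => h.elim i⟩
  · obtain ⟨i, hi⟩ := Finite.exists_min d
    exact ⟨d i / 2, half_pos (hd i), fun j => (half_lt_self (hd i)).trans_le (hi j)⟩

/-! ### Ranking the arguments of a trace by importance -/

/-- From `a` to `b`, the argument `c` is increased and the arguments in `Z` are kept, while all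
others are decreased. -/
structure Raises {n : ℕ} (Z : Finset (Fin n)) (c : Fin n) (a b : Fin n ↪o ℚ) : Prop where
  eq : ∀ i ∈ Z, a i = b i
  lt : a c < b c
  gt : ∀ i ∉ Z, i ≠ c → b i < a i

/-- The change from `a` to `b` does not move an argument past another one. -/
def Slight {n : ℕ} (a b : Fin n ↪o ℚ) : Prop := ∀ i j, i < j → a i < b j ∧ b i < a j

theorem Raises.lt_iff {n : ℕ} {Z : Finset (Fin n)} {c : Fin n} {a b : Fin n ↪o ℚ}
    (h : Raises Z c a b) (hs : Slight a b) (i j : Fin n) : a i < b j ↔ i < j ∨ i = j ∧ i = c := by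
  rcases lt_trichotomy i j with hij | rfl | hij
  · simp [hij, (hs i j hij).1]
  · simp only [lt_irrefl, true_and, false_or]
    refine ⟨fun hl => ?_, fun hc => hc ▸ h.lt⟩
    by_contra hc
    by_cases hz : i ∈ Z
    · exact hl.ne (h.eq i hz)
    · exact hl.not_gt (h.gt i hz hc)
  · simp [hij.not_gt, hij.ne', (hs j i hij).2.le]

theorem Raises.gt_iff {n : ℕ} {Z : Finset (Fin n)} {c : Fin n} {a b : Fin n ↪o ℚ}
    (h : Raises Z c a b) (hs : Slight a b) (i j : Fin n) :
    b j < a i ↔ j < i ∨ i = j ∧ i ∉ Z ∧ i ≠ c := by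
  rcases lt_trichotomy i j with hij | rfl | hij
  · simp [hij.not_gt, hij.ne, (hs i j hij).1.le]
  · simp only [lt_irrefl, true_and, false_or]
    refine ⟨fun hl => ⟨fun hz => hl.ne' (h.eq i hz), ?_⟩, fun hc => h.gt i hc.1 hc.2⟩
    rintro rfl
    exact hl.not_gt h.lt
  · simp [hij, (hs j i hij).2]

/-- A slight change leaves all comparisons between different positions as they are, so `Z` and `c`
determine the whole order pattern of the pair. One instance thus decides all of them. -/
theorem Raises.app_lt_congr (s : Tr D) {Z : Finset (Fin s.n)} {c : Fin s.n}
    {a b a' b' : Fin s.n ↪o ℚ} (h : Raises Z c a b) (hs : Slight a b) (h' : Raises Z c a' b')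
    (hs' : Slight a' b') : s.app a < s.app b ↔ s.app a' < s.app b' :=
  DilatorDichotomy.app_lt_congr _ _ _ _ _ _ (fun i j => by rw [h.lt_iff hs, h'.lt_iff hs'])
    (fun i j => by rw [h.gt_iff hs, h'.gt_iff hs'])

/-- Widely spaced arguments, in which the elements of `T` have been raised, each at the cost of
the others. -/
noncomputable def spaced {n : ℕ} (Z T : Finset (Fin n)) : Fin n ↪o ℚ :=
  OrderEmbedding.ofStrictMono
    -- The displacements lie between `-n` and `n + 1`, so a spacing of `2n + 2` keeps the positions
    -- apart, even across different `T`. Adding an element to `T` raises it by `n` and lowers the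
    -- other elements outside `Z` by `1`.
    (fun i => (2 * n + 2) * (i : ℚ) +
      if i ∈ Z then 0 else (if i ∈ T then (n : ℚ) + 1 else 0) - T.card) (by
    intro i j hij
    have h1 : ((i : ℕ) : ℚ) + 1 ≤ (j : ℕ) := by exact_mod_cast hij
    have h2 : (T.card : ℚ) ≤ n := by
      exact_mod_cast (Finset.card_le_univ T).trans (by simp)
    have h3 : (0 : ℚ) ≤ T.card := by positivity
    have h4 : ((2 * n + 2 : ℚ)) * ((i : ℕ) + 1) ≤ (2 * n + 2) * (j : ℕ) := by gcongr
    dsimp only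
    split_ifs <;> linarith)

theorem spaced_apply {n : ℕ} (Z T : Finset (Fin n)) (i : Fin n) :
    spaced Z T i = (2 * n + 2) * (i : ℚ) +
      if i ∈ Z then 0 else (if i ∈ T then (n : ℚ) + 1 else 0) - T.card := rfl

theorem slight_spaced {n : ℕ} (Z T T' : Finset (Fin n)) : Slight (spaced Z T) (spaced Z T') := by
  have key : ∀ (T T' : Finset (Fin n)) (i j : Fin n), i < j → spaced Z T i < spaced Z T' j := by
    intro T T' i j hij
    have h1 : ((i : ℕ) : ℚ) + 1 ≤ (j : ℕ) := by exact_mod_cast hij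
    have h2 : (T.card : ℚ) ≤ n := by
      exact_mod_cast (Finset.card_le_univ T).trans (by simp)
    have h2' : (T'.card : ℚ) ≤ n := by
      exact_mod_cast (Finset.card_le_univ T').trans (by simp)
    have h3 : (0 : ℚ) ≤ T.card := by positivity
    have h3' : (0 : ℚ) ≤ T'.card := by positivity
    have h4 : ((2 * n + 2 : ℚ)) * ((i : ℕ) + 1) ≤ (2 * n + 2) * (j : ℕ) := by gcongr
    rw [spaced_apply, spaced_apply]
    split_ifs <;> linarith
  exact fun i j hij => ⟨key _ _ i j hij, key _ _ i j hij⟩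

theorem raises_spaced {n : ℕ} (Z T : Finset (Fin n)) (c : Fin n) (hc : c ∉ Z) (hT : c ∉ T) :
    Raises Z c (spaced Z T) (spaced Z (insert c T)) where
  eq i hi := by simp [spaced_apply, hi]
  lt := by
    have : (0 : ℚ) < n := by exact_mod_cast c.pos
    simp only [spaced_apply, hc, hT, Finset.card_insert_of_notMem, if_false, not_false_eq_true,
      Finset.mem_insert_self, if_true]
    push_cast
    linarith
  gt i hi hic := by
    simp only [spaced_apply, hi, hT, Finset.card_insert_of_notMem, if_false, not_false_eq_true,
      Finset.mem_insert, hic, false_or]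
    push_cast
    linarith

/-- If no position were dominant, then raising each position outside `Z` in turn, at the cost of the
others, would never increase the value. But after a full round every argument outside `Z` has risen,
which contradicts monotonicity. -/
theorem exists_slight_dominant (s : Tr D) (Z : Finset (Fin s.n)) (hZ : Z ≠ Finset.univ) :
    ∃ c ∉ Z, ∀ a b, Raises Z c a b → Slight a b → s.app a < s.app b := by
  by_contra! H
  have key : ∀ T : Finset (Fin s.n), (∀ i ∈ T, i ∉ Z) →
      s.app (spaced Z T) ≤ s.app (spaced Z ∅) := by
    intro T
    induction T using Finset.induction_on with
    | empty => exact fun _ => le_rfl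
    | insert c T hcT ih =>
      intro hT
      have hc := hT c (Finset.mem_insert_self _ _)
      refine le_trans ?_ (ih fun i hi => hT i (Finset.mem_insert_of_mem hi))
      obtain ⟨a, b, hab, hs, hle⟩ := H c hc
      have := Raises.app_lt_congr s hab hs (raises_spaced Z T c hc hcT) (slight_spaced _ _ _)
      exact not_lt.1 fun h => hle.not_gt (this.2 h)
  obtain ⟨c, hc⟩ : ∃ c, c ∉ Z := by
    by_contra! h
    exact hZ (Finset.eq_univ_iff_forall.2 h)
  have hcard : ((Zᶜ).card : ℚ) ≤ s.n := by
    exact_mod_cast (Finset.card_le_univ Zᶜ).trans (by simp)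
  -- The net gain of each argument outside `Z` is `n + 1` minus the cardinality of `Zᶜ`, which is
  -- positive.
  refine (key Zᶜ fun i hi => Finset.mem_compl.1 hi).not_gt (s.app_lt (fun i => ?_) c ?_)
  · rw [spaced_apply, spaced_apply]
    by_cases hi : i ∈ Z
    · simp [hi]
    · simp only [hi, if_false, Finset.notMem_empty, Finset.mem_compl, not_false_eq_true, if_true,
        Finset.card_empty, Nat.cast_zero]
      linarith
  · rw [spaced_apply, spaced_apply]
    simp only [hc, if_false, Finset.notMem_empty, Finset.mem_compl, not_false_eq_true, if_true,
        Finset.card_empty, Nat.cast_zero]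
    linarith

theorem exists_gap {n : ℕ} (a : Fin n → ℚ) (ha : StrictMono a) :
    ∃ ε > 0, ∀ i j, i < j → ε < a j - a i := by
  obtain ⟨ε, h0, h⟩ := exists_pos_lt (fun p : {p : Fin n × Fin n // p.1 < p.2} => a p.1.2 - a p.1.1)
    fun p => sub_pos.2 (ha p.2)
  exact ⟨ε, h0, fun i j hij => h ⟨(i, j), hij⟩⟩

/-- A large change decomposes into slight ones. -/
theorem app_lt_of_slight (s : Tr D) (Z : Finset (Fin s.n)) (c : Fin s.n)
    (hs : ∀ a b, Raises Z c a b → Slight a b → s.app a < s.app b) (a b : Fin s.n ↪o ℚ)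
    (hab : Raises Z c a b) : s.app a < s.app b := by
  obtain ⟨ε₁, h₁, ha⟩ := exists_gap a a.strictMono
  obtain ⟨ε₂, h₂, hb⟩ := exists_gap b b.strictMono
  obtain ⟨ε, hε, hε₁, hε₂⟩ : ∃ ε > 0, ε ≤ ε₁ ∧ ε ≤ ε₂ :=
    ⟨min ε₁ ε₂, lt_min h₁ h₂, min_le_left _ _, min_le_right _ _⟩
  obtain ⟨N, hN⟩ := exists_nat_gt ((∑ i, |b i - a i|) / ε)
  have hN0 : (0 : ℚ) < N := lt_of_le_of_lt (by positivity) hN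
  have hsmall : ∀ i, |(b i - a i) / N| < ε := fun i => by
    rw [abs_div, abs_of_pos hN0, div_lt_iff₀ hN0]
    rw [div_lt_iff₀ hε] at hN
    have := Finset.single_le_sum (f := fun i => |b i - a i|) (fun i _ => abs_nonneg _)
      (Finset.mem_univ i)
    linarith
  -- The change is made in `N` equal steps along the segment from `a` to `b`. The gaps of an
  -- intermediate point are convex combinations of those of `a` and `b`, hence exceed `ε`, while
  -- each step moves every argument by less than `ε`.
  have key : ∀ j : ℕ, j ≤ N → ∃ p : Fin s.n ↪o ℚ,
      (∀ i, p i = a i + j * ((b i - a i) / N)) ∧ s.app a ≤ s.app p := by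
    have gap : ∀ j : ℕ, j ≤ N → ∀ i k, i < k →
        ε < (a k + j * ((b k - a k) / N)) - (a i + j * ((b i - a i) / N)) := by
      intro j hj i k hik
      have hj' : (j : ℚ) / N ≤ 1 := (div_le_one hN0).2 (by exact_mod_cast hj)
      have hj0 : (0 : ℚ) ≤ j / N := by positivity
      have e : (a k + j * ((b k - a k) / N)) - (a i + j * ((b i - a i) / N)) =
          (1 - j / N) * (a k - a i) + j / N * (b k - b i) := by ring
      rw [e]
      have := hε₁.trans_lt (ha i k hik)
      have := hε₂.trans_lt (hb i k hik)
      rcases hj0.eq_or_lt with h0 | h0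
      · rw [← h0]; linarith
      · nlinarith
    intro j
    induction j with
    | zero => exact fun _ => ⟨a, by simp, le_rfl⟩
    | succ j ih =>
      intro hj
      obtain ⟨p, hp, hle⟩ := ih (by omega)
      let q : Fin s.n ↪o ℚ := OrderEmbedding.ofStrictMono
        (fun i => a i + (j + 1 : ℕ) * ((b i - a i) / N)) fun i k hik => by
          have := gap (j + 1) hj i k hik
          dsimp only
          linarith
      have hq : ∀ i, q i = p i + (b i - a i) / N := fun i => by
        rw [hp]
        change a i + (j + 1 : ℕ) * ((b i - a i) / N) = _
        push_cast
        ring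
      refine ⟨q, fun i => rfl, hle.trans (hs p q ⟨fun i hi => ?_, ?_, fun i hi hic => ?_⟩
        fun i k hik => ?_).le⟩
      · rw [hq, hab.eq i hi]; simp
      · rw [hq]
        have := div_pos (sub_pos.2 hab.lt) hN0
        linarith
      · rw [hq]
        have := div_neg_of_neg_of_pos (sub_neg.2 (hab.gt i hi hic)) hN0
        linarith
      · have := gap j (by omega) i k hik
        rw [← hp, ← hp] at this
        have h1 := abs_lt.1 (hsmall i)
        have h2 := abs_lt.1 (hsmall k)
        rw [hq, hq]
        constructor <;> linarith
  obtain ⟨p, hp, hle⟩ := key N le_rfl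
  have hpb : p = b := DFunLike.ext _ _ fun i => by
    rw [hp, mul_div_cancel₀ _ hN0.ne']; ring
  rw [hpb] at hle
  exact hle.lt_of_ne fun h => hab.lt.ne (by rw [s.app_injective h])

/-- If the arguments in `Z` are kept, then one other argument decides about the order. -/
theorem exists_dominant (s : Tr D) (Z : Finset (Fin s.n)) (hZ : Z ≠ Finset.univ) :
    ∃ c ∉ Z, ∀ a b : Fin s.n ↪o ℚ, (∀ i ∈ Z, a i = b i) → a c < b c → s.app a < s.app b := by
  obtain ⟨c, hc, h⟩ := exists_slight_dominant s Z hZ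
  refine ⟨c, hc, fun a b hab hlt => ?_⟩
  obtain ⟨ε₁, h₁, hm⟩ := exists_gap (fun i => min (a i) (b i))
    fun i j hij => min_lt_min (a.strictMono hij) (b.strictMono hij)
  obtain ⟨ε, hε, hε₁, hε₂⟩ : ∃ ε > 0, 2 * ε ≤ ε₁ ∧ ε ≤ b c - a c :=
    ⟨min (ε₁ / 2) (b c - a c), lt_min (by linarith) (by linarith),
      by linarith [min_le_left (ε₁ / 2) (b c - a c)], min_le_right _ _⟩
  -- An intermediate point below `b`: argument `c` is raised by at most `b c - a c`, and those
  -- outside `Z` other than `c` drop below `a`. Then `a` to `b'` is a raise of `c`, and `b'` to `b`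
  -- is covered by monotonicity.
  let b' : Fin s.n ↪o ℚ := OrderEmbedding.ofStrictMono
    (fun i => min (a i) (b i) + if i ∈ Z then 0 else if i = c then ε else -ε) fun i j hij => by
      have := hm i j hij
      dsimp only at this ⊢
      split_ifs <;> linarith
  have hb' : ∀ i, b' i = min (a i) (b i) + if i ∈ Z then 0 else if i = c then ε else -ε :=
    fun _ => rfl
  refine (app_lt_of_slight s Z c h a b' ⟨fun i hi => ?_, ?_, fun i hi hic => ?_⟩).trans_le
    (s.app_mono fun i => ?_)
  · rw [hb', ← hab i hi]; simp [hi]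
  · rw [hb', min_eq_left hlt.le]; simp [hc, hε]
  · rw [hb', if_neg hi, if_neg hic]
    linarith [min_le_left (a i) (b i)]
  · rw [hb']
    split_ifs with h1 h2
    · simp
    · subst h2
      linarith [min_le_left (a i) (b i)]
    · linarith [min_le_right (a i) (b i)]

/-- The dominant argument over `Z = ∅` is the most important one. It is added to `Z`, and the choice
is repeated until `Z` is everything. -/
theorem exists_priority (s : Tr D) : ∃ π : Fin s.n → Fin s.n, Function.Injective π ∧
    ∀ (a b : Fin s.n ↪o ℚ) (k : Fin s.n), (∀ j < k, a (π j) = b (π j)) → a (π k) < b (π k) →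
      s.app a < s.app b := by
  classical
  rcases isEmpty_or_nonempty (Fin s.n) with he | he
  · exact ⟨id, Function.injective_id, fun _ _ k => he.elim k⟩
  choose! c hcZ hc using exists_dominant s
  let Zs : ℕ → Finset (Fin s.n) := fun k => Nat.rec ∅ (fun _ Z => insert (c Z) Z) k
  have hZs : ∀ k, Zs (k + 1) = insert (c (Zs k)) (Zs k) := fun _ => rfl
  have hcard : ∀ k, k ≤ s.n → (Zs k).card = k := by
    intro k
    induction k with
    | zero => exact fun _ => rfl
    | succ k ih =>
      intro hk
      have h1 := ih (by omega)
      have h2 : Zs k ≠ Finset.univ := fun h => by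
        rw [h, Finset.card_univ, Fintype.card_fin] at h1; omega
      rw [hZs, Finset.card_insert_of_notMem (hcZ _ h2), h1]
  have hne : ∀ k : Fin s.n, Zs k ≠ Finset.univ := fun k h => by
    have h1 := hcard k k.2.le
    rw [h, Finset.card_univ, Fintype.card_fin] at h1
    exact k.2.ne h1.symm
  have hmem : ∀ (k : ℕ) (i : Fin s.n), i ∈ Zs k ↔ ∃ j < k, c (Zs j) = i := by
    intro k i
    induction k with
    | zero => simp [show Zs 0 = ∅ from rfl]
    | succ k ih =>
      rw [hZs, Finset.mem_insert, ih]
      constructor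
      · rintro (h | ⟨j, hj, h⟩)
        · exact ⟨k, by omega, h.symm⟩
        · exact ⟨j, by omega, h⟩
      · rintro ⟨j, hj, h⟩
        rcases (Nat.lt_succ_iff.1 hj).eq_or_lt with rfl | hj
        · exact .inl h.symm
        · exact .inr ⟨j, hj, h⟩
  refine ⟨fun k => c (Zs k), fun j k hjk => ?_, fun a b k hk hlt => ?_⟩
  · by_contra hne'
    dsimp only at hjk
    rcases lt_or_gt_of_ne hne' with h | h
    · exact hcZ _ (hne k) ((hmem _ _).2 ⟨j, h, hjk⟩)
    · exact hcZ _ (hne j) ((hmem _ _).2 ⟨k, h, hjk.symm⟩)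
  · refine hc _ (hne k) a b (fun i hi => ?_) hlt
    obtain ⟨j, hj, rfl⟩ := (hmem _ _).1 hi
    exact hk ⟨j, hj.trans k.2⟩ hj

/-- The enumeration of the arguments by decreasing importance. -/
noncomputable def Tr.prio (s : Tr D) : Fin s.n → Fin s.n := (exists_priority s).choose

theorem Tr.prio_injective (s : Tr D) : Function.Injective s.prio :=
  (exists_priority s).choose_spec.1

theorem Tr.prio_surjective (s : Tr D) : Function.Surjective s.prio :=
  Finite.injective_iff_surjective.1 s.prio_injective

theorem Tr.app_lt_of_prio (s : Tr D) (a b : Fin s.n ↪o ℚ) (k : Fin s.n)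
    (h : ∀ j < k, a (s.prio j) = b (s.prio j)) (hk : a (s.prio k) < b (s.prio k)) :
    s.app a < s.app b :=
  (exists_priority s).choose_spec.2 a b k h hk

/-! ### Comparing two traces that share their most important arguments -/

/-- The `q` most important arguments agree. -/
def Pre (s t : Tr D) (q : ℕ) (a : Fin s.n ↪o α) (b : Fin t.n ↪o α) : Prop :=
  ∀ (k : ℕ) (hs : k < s.n) (ht : k < t.n), k < q → a (s.prio ⟨k, hs⟩) = b (t.prio ⟨k, ht⟩)

theorem Pre.symm {s t : Tr D} {q : ℕ} {a : Fin s.n ↪o α} {b : Fin t.n ↪o α} (h : Pre s t q a b) :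
    Pre t s q b a := fun k hs ht hk => (h k ht hs hk).symm

theorem Pre.trans_embedding {s t : Tr D} {q : ℕ} {a : Fin s.n ↪o α} {b : Fin t.n ↪o α}
    (h : Pre s t q a b) (φ : α ↪o β) : Pre s t q (a.trans φ) (b.trans φ) :=
  fun k hs ht hk => congrArg φ (h k hs ht hk)

theorem Pre.prio_lt_iff {s t : Tr D} {q : ℕ} {a : Fin s.n ↪o α} {b : Fin t.n ↪o α}
    (h : Pre s t q a b) {j k : ℕ} (hj : j < q) (hk : k < q) (hjs : j < s.n) (hks : k < s.n)
    (hjt : j < t.n) (hkt : k < t.n) :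
    s.prio ⟨j, hjs⟩ < s.prio ⟨k, hks⟩ ↔ t.prio ⟨j, hjt⟩ < t.prio ⟨k, hkt⟩ := by
  rw [← a.lt_iff_lt, ← b.lt_iff_lt, h j hjs hjt hj, h k hks hkt hk]

/-- Raising the argument of `s` and lowering that of `t` preserves `t < s`. -/
theorem lt_of_shift {s t : Tr D} {q : ℕ} (hs : q < s.n) (ht : q < t.n) {a₀ a : Fin s.n ↪o ℚ}
    {b₀ b : Fin t.n ↪o ℚ} (h₀ : Pre s t q a₀ b₀) (h : Pre s t q a b) (hle : t.app b₀ ≤ s.app a₀)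
    {A B : ℚ} (hA : a₀ (s.prio ⟨q, hs⟩) < A) (hB : B < b₀ (t.prio ⟨q, ht⟩))
    (hAk : ∀ k (hk : k < q), (a₀ (s.prio ⟨k, hk.trans hs⟩) < A ↔
      a₀ (s.prio ⟨k, hk.trans hs⟩) < a₀ (s.prio ⟨q, hs⟩)) ∧
      (A < a₀ (s.prio ⟨k, hk.trans hs⟩) ↔
      a₀ (s.prio ⟨q, hs⟩) < a₀ (s.prio ⟨k, hk.trans hs⟩)))
    (hBk : ∀ k (hk : k < q), (a₀ (s.prio ⟨k, hk.trans hs⟩) < B ↔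
      a₀ (s.prio ⟨k, hk.trans hs⟩) < b₀ (t.prio ⟨q, ht⟩)) ∧
      (B < a₀ (s.prio ⟨k, hk.trans hs⟩) ↔
      b₀ (t.prio ⟨q, ht⟩) < a₀ (s.prio ⟨k, hk.trans hs⟩)))
    (hAB : (a (s.prio ⟨q, hs⟩) < b (t.prio ⟨q, ht⟩) ↔ A < B) ∧
      (b (t.prio ⟨q, ht⟩) < a (s.prio ⟨q, hs⟩) ↔ B < A)) : t.app b < s.app a := by
  -- Only the `q` shared arguments and the two next ones matter. The assumptions say that they have
  -- the same pattern as the old shared arguments with `A` and `B`, so an embedding `φ` of the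
  -- rationals carries one family to the other.
  let w : Option (Option (Fin q)) → ℚ := fun o => o.elim (a (s.prio ⟨q, hs⟩)) fun o =>
    o.elim (b (t.prio ⟨q, ht⟩)) fun k => a (s.prio ⟨k, k.2.trans hs⟩)
  let w' : Option (Option (Fin q)) → ℚ := fun o => o.elim A fun o =>
    o.elim B fun k => a₀ (s.prio ⟨k, k.2.trans hs⟩)
  obtain ⟨φ, hφ⟩ := exists_embedding_extending w w' (by
    rintro (_ | _ | j) (_ | _ | k)
    · simp [w, w']
    · exact hAB.1
    · exact (((hAk k k.2).2.trans a₀.lt_iff_lt).trans a.lt_iff_lt.symm).symm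
    · exact hAB.2
    · simp [w, w']
    · refine Iff.trans ?_ (hBk k k.2).2.symm
      change b _ < a _ ↔ _
      rw [h k (k.2.trans hs) (k.2.trans ht) k.2, h₀ k (k.2.trans hs) (k.2.trans ht) k.2]
      exact b.lt_iff_lt.trans b₀.lt_iff_lt.symm
    · exact (((hAk j j.2).1.trans a₀.lt_iff_lt).trans a.lt_iff_lt.symm).symm
    · refine Iff.trans ?_ (hBk j j.2).1.symm
      change a _ < b _ ↔ _
      rw [h j (j.2.trans hs) (j.2.trans ht) j.2, h₀ j (j.2.trans hs) (j.2.trans ht) j.2]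
      exact b.lt_iff_lt.trans b₀.lt_iff_lt.symm
    · exact a.lt_iff_lt.trans a₀.lt_iff_lt.symm)
  rw [← app_trans_lt _ _ _ _ φ]
  have hk : ∀ k (hk : k < q), φ (a (s.prio ⟨k, hk.trans hs⟩)) = a₀ (s.prio ⟨k, hk.trans hs⟩) :=
    fun k hk => hφ (some (some ⟨k, hk⟩))
  refine lt_of_lt_of_le (t.app_lt_of_prio _ b₀ ⟨q, ht⟩ (fun j hj => ?_) ?_)
    (hle.trans (s.app_lt_of_prio a₀ _ ⟨q, hs⟩ (fun j hj => ?_) ?_).le)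
  · have hj' : (j : ℕ) < q := hj
    change φ (b _) = _
    rw [← h j (hj'.trans hs) j.2 hj', hk j hj', h₀ j (hj'.trans hs) j.2 hj']
  · exact lt_of_eq_of_lt (hφ (some none)) hB
  · exact (hk j hj).symm
  · exact lt_of_lt_of_eq hA (hφ none).symm

/-- From the given comparison, the next argument `x` of `s` may be raised and the next argument `y`
of `t` lowered within their intervals. If the intervals differ, the shared arguments fix the pattern
of the two next arguments; if they coincide and `x < y`, every pattern can be realized between `x`
and `y`. If they coincide and `y ≤ x`, just the pattern with the argument of `t` below that of `s`
is obtained. -/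
theorem lt_or_cut {s t : Tr D} {q : ℕ} (hs : q < s.n) (ht : q < t.n) {a₀ : Fin s.n ↪o ℚ}
    {b₀ : Fin t.n ↪o ℚ} (h₀ : Pre s t q a₀ b₀) (hle : t.app b₀ ≤ s.app a₀) :
    (∀ (a : Fin s.n ↪o ℚ) (b : Fin t.n ↪o ℚ), Pre s t q a b → t.app b < s.app a) ∨
    ((∀ k (hk : k < q), s.prio ⟨k, hk.trans hs⟩ < s.prio ⟨q, hs⟩ ↔
        t.prio ⟨k, hk.trans ht⟩ < t.prio ⟨q, ht⟩) ∧
      ∀ (a : Fin s.n ↪o ℚ) (b : Fin t.n ↪o ℚ), Pre s t q a b →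
        b (t.prio ⟨q, ht⟩) < a (s.prio ⟨q, hs⟩) → t.app b < s.app a) := by
  set x := a₀ (s.prio ⟨q, hs⟩) with hx
  set y := b₀ (t.prio ⟨q, ht⟩) with hy
  let z : Fin q → ℚ := fun k => a₀ (s.prio ⟨k, k.2.trans hs⟩)
  have hz : ∀ k : Fin q, z k = b₀ (t.prio ⟨k, k.2.trans ht⟩) :=
    fun k => h₀ k (k.2.trans hs) (k.2.trans ht) k.2
  have hzx : ∀ k, z k ≠ x := fun k h => k.2.ne
    (Fin.mk.inj (s.prio_injective (a₀.injective h)))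
  have hzy : ∀ k, z k ≠ y := fun k h => k.2.ne
    (Fin.mk.inj (t.prio_injective (b₀.injective ((hz k).symm.trans h))))
  -- With this `ε`, moving to `x + ε` and `y - ε` does not pass any of the shared arguments.
  obtain ⟨ε, hε, h1⟩ := exists_pos_lt
    (Sum.elim (fun k => |z k - x|) (fun k => |z k - y|)) (by
      rintro (k | k)
      · exact abs_pos.2 (sub_ne_zero.2 (hzx k))
      · exact abs_pos.2 (sub_ne_zero.2 (hzy k)))
  have hεx : ∀ k, ε < |z k - x| := fun k => h1 (.inl k)
  have hεy : ∀ k, ε < |z k - y| := fun k => h1 (.inr k)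
  have cutA : ∀ k (hk : k < q), (z ⟨k, hk⟩ < x + ε ↔ z ⟨k, hk⟩ < x) ∧
      (x + ε < z ⟨k, hk⟩ ↔ x < z ⟨k, hk⟩) := fun k hk => by
    have := hεx ⟨k, hk⟩
    rcases (hzx ⟨k, hk⟩).lt_or_gt with h | h
    · exact ⟨by constructor <;> intro <;> linarith, by constructor <;> intro <;> linarith⟩
    · rw [abs_of_pos (by linarith)] at this
      exact ⟨by constructor <;> intro <;> linarith, by constructor <;> intro <;> linarith⟩
  have cutB : ∀ k (hk : k < q), (z ⟨k, hk⟩ < y - ε ↔ z ⟨k, hk⟩ < y) ∧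
      (y - ε < z ⟨k, hk⟩ ↔ y < z ⟨k, hk⟩) := fun k hk => by
    have := hεy ⟨k, hk⟩
    rcases (hzy ⟨k, hk⟩).lt_or_gt with h | h
    · rw [abs_of_neg (by linarith)] at this
      exact ⟨by constructor <;> intro <;> linarith, by constructor <;> intro <;> linarith⟩
    · exact ⟨by constructor <;> intro <;> linarith, by constructor <;> intro <;> linarith⟩
  by_cases hcut : ∀ k, z k < x ↔ z k < y
  · by_cases hxy : x < y
    · left
      intro a b h
      have cut : ∀ C, x < C → C < y → ∀ k (hk : k < q), ((z ⟨k, hk⟩ < C ↔ z ⟨k, hk⟩ < x) ∧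
          (C < z ⟨k, hk⟩ ↔ x < z ⟨k, hk⟩)) ∧ ((z ⟨k, hk⟩ < C ↔ z ⟨k, hk⟩ < y) ∧
          (C < z ⟨k, hk⟩ ↔ y < z ⟨k, hk⟩)) := fun C hC hC' k hk => by
        rw [← hcut ⟨k, hk⟩]
        rcases (hzx ⟨k, hk⟩).lt_or_gt with h | h
        · refine ⟨⟨?_, ?_⟩, ?_, ?_⟩ <;> constructor <;> intro <;> linarith
        · have : y < z ⟨k, hk⟩ := lt_of_le_of_ne
            (not_lt.1 fun hl => h.not_gt ((hcut ⟨k, hk⟩).2 hl)) (hzy _).symm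
          refine ⟨⟨?_, ?_⟩, ?_, ?_⟩ <;> constructor <;> intro <;> linarith
      obtain ⟨C, hC, hC'⟩ := exists_between hxy
      obtain ⟨E, hE, hE'⟩ := exists_between hC'
      rcases lt_trichotomy (a (s.prio ⟨q, hs⟩)) (b (t.prio ⟨q, ht⟩)) with hab | hab | hab
      · exact lt_of_shift hs ht h₀ h hle hC hE' (fun k hk => (cut C hC hC' k hk).1)
          (fun k hk => (cut E (hC.trans hE) hE' k hk).2) ⟨iff_of_true hab hE, iff_of_false hab.not_gt hE.not_gt⟩
      · exact lt_of_shift hs ht h₀ h hle hC hC' (fun k hk => (cut C hC hC' k hk).1)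
          (fun k hk => (cut C hC hC' k hk).2) (by simp [hab])
      · exact lt_of_shift hs ht h₀ h hle (hC.trans hE) hC'
          (fun k hk => (cut E (hC.trans hE) hE' k hk).1)
          (fun k hk => (cut C hC hC' k hk).2) ⟨iff_of_false hab.not_gt hE.not_gt, iff_of_true hab hE⟩
    · right
      refine ⟨fun k hk => ?_, fun a b h hba => ?_⟩
      · have := hcut ⟨k, hk⟩
        rw [hz ⟨k, hk⟩] at this
        rw [← a₀.lt_iff_lt, ← b₀.lt_iff_lt, ← this, ← hz ⟨k, hk⟩]
      · have : y - ε < x + ε := by linarith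
        exact lt_of_shift hs ht h₀ h hle (lt_add_of_pos_right _ hε) (sub_lt_self _ hε) cutA cutB
          ⟨iff_of_false hba.not_gt this.not_gt, iff_of_true hba this⟩
  · left
    intro a b h
    refine lt_of_shift hs ht h₀ h hle (lt_add_of_pos_right _ hε) (sub_lt_self _ hε) cutA cutB ?_
    push Not at hcut
    obtain ⟨⟨k, hk⟩, hcut⟩ := hcut
    have hk' := h k (hk.trans hs) (hk.trans ht) hk
    -- A shared argument separates `x` from `y`. It separates the next arguments of `a` and `b` in
    -- the same way.
    rcases hcut with ⟨h1, h2⟩ | ⟨h1, h2⟩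
    · have h2 : y < z ⟨k, hk⟩ := h2.lt_of_ne (hzy _).symm
      have e1 : a (s.prio ⟨k, hk.trans hs⟩) < a (s.prio ⟨q, hs⟩) :=
        a.lt_iff_lt.2 (a₀.lt_iff_lt.1 h1)
      have e2 : b (t.prio ⟨q, ht⟩) < b (t.prio ⟨k, hk.trans ht⟩) :=
        b.lt_iff_lt.2 (b₀.lt_iff_lt.1 (h2.trans_eq (hz ⟨k, hk⟩)))
      rw [← hk'] at e2
      have e3 := e2.trans e1
      have e4 := ((cutB k hk).2.2 h2).trans ((cutA k hk).1.2 h1)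
      exact ⟨iff_of_false e3.not_gt e4.not_gt, iff_of_true e3 e4⟩
    · have h1 : x < z ⟨k, hk⟩ := h1.lt_of_ne (hzx _).symm
      have e1 : a (s.prio ⟨q, hs⟩) < a (s.prio ⟨k, hk.trans hs⟩) :=
        a.lt_iff_lt.2 (a₀.lt_iff_lt.1 h1)
      have e2 : b (t.prio ⟨k, hk.trans ht⟩) < b (t.prio ⟨q, ht⟩) :=
        b.lt_iff_lt.2 (b₀.lt_iff_lt.1 (lt_of_eq_of_lt (hz ⟨k, hk⟩).symm h2))
      rw [← hk'] at e2
      have e3 := e1.trans e2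
      have e4 := ((cutA k hk).2.2 h1).trans ((cutB k hk).1.2 h2)
      exact ⟨iff_of_true e3 e4, iff_of_false e3.not_gt e4.not_gt⟩

/-- When the `q` most important arguments agree, then the next arguments lie in the same interval
and decide about the order. -/
structure TieComparable (s t : Tr D) (q : ℕ) : Prop where
  hs : q < s.n
  ht : q < t.n
  cut : ∀ (j k : ℕ) (hj : j ≤ q) (hk : k ≤ q),
    s.prio ⟨j, hj.trans_lt hs⟩ < s.prio ⟨k, hk.trans_lt hs⟩ ↔
      t.prio ⟨j, hj.trans_lt ht⟩ < t.prio ⟨k, hk.trans_lt ht⟩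
  lt : ∀ (a : Fin s.n ↪o ℚ) (b : Fin t.n ↪o ℚ), Pre s t q a b →
    a (s.prio ⟨q, hs⟩) < b (t.prio ⟨q, ht⟩) → s.app a < t.app b
  gt : ∀ (a : Fin s.n ↪o ℚ) (b : Fin t.n ↪o ℚ), Pre s t q a b →
    b (t.prio ⟨q, ht⟩) < a (s.prio ⟨q, hs⟩) → t.app b < s.app a

theorem TieComparable.symm {s t : Tr D} {q : ℕ} (h : TieComparable s t q) :
    TieComparable t s q where
  hs := h.ht
  ht := h.hs
  cut j k hj hk := (h.cut j k hj hk).symm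
  lt a b hab := h.gt b a hab.symm
  gt a b hab := h.lt b a hab.symm

/-- When the `q` most important arguments agree and are the only arguments on one side, then the
order does not depend on the arguments. -/
theorem app_lt_iff_of_pre {s t : Tr D} {q : ℕ} (hs : q ≤ s.n) (ht : q ≤ t.n)
    (h : s.n ≤ q ∨ t.n ≤ q) {a₀ a : Fin s.n ↪o ℚ} {b₀ b : Fin t.n ↪o ℚ} (h₀ : Pre s t q a₀ b₀)
    (h₁ : Pre s t q a b) : t.app b₀ < s.app a₀ ↔ t.app b < s.app a := by
  rcases h with h | h
  · have key : ∀ i : Fin s.n, ∃ j : Fin t.n, a₀ i = b₀ j ∧ a i = b j := fun i => by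
      obtain ⟨k, rfl⟩ := s.prio_surjective i
      exact ⟨_, h₀ k k.2 (k.2.trans_le (h.trans ht)) (k.2.trans_le h),
        h₁ k k.2 (k.2.trans_le (h.trans ht)) (k.2.trans_le h)⟩
    refine app_lt_congr _ _ _ _ _ _ (fun j i => ?_) (fun j i => ?_) <;>
    · obtain ⟨l, h1, h2⟩ := key i
      rw [h1, h2, b₀.lt_iff_lt, b.lt_iff_lt]
  · have key : ∀ i : Fin t.n, ∃ j : Fin s.n, b₀ i = a₀ j ∧ b i = a j := fun i => by
      obtain ⟨k, rfl⟩ := t.prio_surjective i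
      exact ⟨_, (h₀ k (k.2.trans_le (h.trans hs)) k.2 (k.2.trans_le h)).symm,
        (h₁ k (k.2.trans_le (h.trans hs)) k.2 (k.2.trans_le h)).symm⟩
    refine app_lt_congr _ _ _ _ _ _ (fun i j => ?_) (fun i j => ?_) <;>
    · obtain ⟨l, h1, h2⟩ := key i
      rw [h1, h2, a₀.lt_iff_lt, a.lt_iff_lt]

/-- The two opposite comparisons rule out the constant alternative of `lt_or_cut` in both
directions, and the other alternatives together are comparability at level `q`. -/
theorem tieComparable_of_not_const {s t : Tr D} {q : ℕ} (hs : q ≤ s.n) (ht : q ≤ t.n)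
    {a₀ a₁ : Fin s.n ↪o ℚ} {b₀ b₁ : Fin t.n ↪o ℚ} (h₀ : Pre s t q a₀ b₀) (h₁ : Pre s t q a₁ b₁)
    (hlt : t.app b₀ < s.app a₀) (hn : ¬ t.app b₁ < s.app a₁) : TieComparable s t q := by
  by_cases h : s.n ≤ q ∨ t.n ≤ q
  · exact absurd ((app_lt_iff_of_pre hs ht h h₀ h₁).1 hlt) hn
  push Not at h
  obtain ⟨hs, ht⟩ := h
  obtain ⟨hcut, hgt⟩ := (lt_or_cut hs ht h₀ hlt.le).resolve_left fun H => hn (H _ _ h₁)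
  obtain ⟨-, hlt'⟩ := (lt_or_cut ht hs h₁.symm (not_lt.1 hn)).resolve_left fun H =>
    hlt.not_gt (H _ _ h₀.symm)
  refine ⟨hs, ht, fun j k hj hk => ?_, fun a b h => hlt' b a h.symm, hgt⟩
  rcases hj.eq_or_lt with rfl | hj <;> rcases hk.eq_or_lt with rfl | hk
  · simp
  · have hne : s.prio ⟨k, hk.trans hs⟩ ≠ s.prio ⟨j, hs⟩ := fun e =>
      hk.ne (Fin.mk.inj (s.prio_injective e))
    have hne' : t.prio ⟨k, hk.trans ht⟩ ≠ t.prio ⟨j, ht⟩ := fun e =>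
      hk.ne (Fin.mk.inj (t.prio_injective e))
    have := hcut k hk
    rw [← not_le, ← not_le, hne.le_iff_lt, hne'.le_iff_lt, this]
  · exact hcut j hj
  · exact h₀.prio_lt_iff hj hk _ _ _ _

/-- An instance of `s` is squeezed between those of `t` and `u`: it gets the same shared arguments,
and its next argument is some `m` between theirs. The equal cuts ensure that this fits the positions
of `s`. -/
theorem TieComparable.trans {s t u : Tr D} {q : ℕ} (h : TieComparable s t q)
    (h' : TieComparable s u q) : TieComparable t u q := by
  have key : ∀ {t u : Tr D}, ∀ (h : TieComparable s t q) (h' : TieComparable s u q)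
      (a : Fin t.n ↪o ℚ) (b : Fin u.n ↪o ℚ), Pre t u q a b →
      a (t.prio ⟨q, h.ht⟩) < b (u.prio ⟨q, h'.ht⟩) → t.app a < u.app b := by
    intro t u h h' a b hab hlt
    obtain ⟨m, hm, hm'⟩ := exists_between hlt
    let e : Fin s.n ↪o ℚ :=
      OrderEmbedding.ofStrictMono (fun i => ((i : ℕ) : ℚ)) fun i j hij =>
        Nat.cast_lt.2 hij
    have hcut : ∀ k : Fin q, (a (t.prio ⟨k, k.2.trans h.ht⟩) < m ↔
        s.prio ⟨k, k.2.trans h.hs⟩ < s.prio ⟨q, h.hs⟩) ∧ (m < a (t.prio ⟨k, k.2.trans h.ht⟩) ↔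
        s.prio ⟨q, h.hs⟩ < s.prio ⟨k, k.2.trans h.hs⟩) := fun k => by
      have c1 := h.cut k q k.2.le le_rfl
      have c2 := h'.cut q k le_rfl k.2.le
      have c3 := hab k (k.2.trans h.ht) (k.2.trans h'.ht) k.2
      rcases lt_trichotomy (s.prio ⟨k, k.2.trans h.hs⟩) (s.prio ⟨q, h.hs⟩) with hl | hl | hl
      · have := (a.lt_iff_lt.2 (c1.1 hl)).trans hm
        exact ⟨iff_of_true this hl, iff_of_false this.not_gt hl.not_gt⟩
      · exact absurd (Fin.mk.inj (s.prio_injective hl)) k.2.ne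
      · have := hm'.trans (b.lt_iff_lt.2 (c2.1 hl))
        rw [← c3] at this
        exact ⟨iff_of_false this.not_gt hl.not_gt, iff_of_true this hl⟩
    obtain ⟨φ, hφ⟩ := exists_embedding_extending
      (fun o : Option (Fin q) => o.elim (e (s.prio ⟨q, h.hs⟩))
        fun k => e (s.prio ⟨k, k.2.trans h.hs⟩))
      (fun o => o.elim m fun k => a (t.prio ⟨k, k.2.trans h.ht⟩)) (by
        rintro (_ | j) (_ | k)
        · simp
        · exact e.lt_iff_lt.trans (hcut k).2.symm
        · exact e.lt_iff_lt.trans (hcut j).1.symm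
        · exact (e.lt_iff_lt.trans (h.cut j k j.2.le k.2.le)).trans a.lt_iff_lt.symm)
    have hk : ∀ k (hk : k < q), φ (e (s.prio ⟨k, hk.trans h.hs⟩)) =
      a (t.prio ⟨k, hk.trans h.ht⟩) := fun k hk => hφ (some ⟨k, hk⟩)
    have hq : φ (e (s.prio ⟨q, h.hs⟩)) = m := hφ none
    have hpre : Pre s t q (e.trans φ) a := fun k _ _ hkq => hk k hkq
    refine (h.gt (e.trans φ) a hpre (hm.trans_eq hq.symm)).trans
      (h'.lt (e.trans φ) b (fun k hs hu hkq => ?_) (lt_of_eq_of_lt hq hm'))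
    exact (hk k hkq).trans (hab k _ _ hkq)
  exact ⟨h.ht, h'.ht, fun j k hj hk => (h.cut j k hj hk).symm.trans (h'.cut j k hj hk),
    key h h', fun a b hab => key h' h b a hab.symm⟩

/-- Comparability is stated over the rationals only; every countable order embeds there, and
embeddings preserve the comparison. -/
theorem TieComparable.app_lt [Countable α] {s t : Tr D} {q : ℕ} (h : TieComparable s t q)
    {a : Fin s.n ↪o α} {b : Fin t.n ↪o α} (hab : Pre s t q a b)
    (hlt : a (s.prio ⟨q, h.hs⟩) < b (t.prio ⟨q, h.ht⟩)) : s.app a < t.app b := by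
  obtain ⟨φ⟩ := Order.embedding_from_countable_to_dense α ℚ
  rw [← app_trans_lt _ _ _ _ φ]
  exact h.lt _ _ (hab.trans_embedding φ) (φ.lt_iff_lt.2 hlt)

theorem tieComparable_of_countable [Countable α] [Countable β] {s t : Tr D} {q : ℕ}
    (hs : q ≤ s.n) (ht : q ≤ t.n) {a₀ : Fin s.n ↪o α} {b₀ : Fin t.n ↪o α} {a₁ : Fin s.n ↪o β}
    {b₁ : Fin t.n ↪o β} (h₀ : Pre s t q a₀ b₀) (h₁ : Pre s t q a₁ b₁)
    (hlt : t.app b₀ < s.app a₀) (hn : ¬ t.app b₁ < s.app a₁) : TieComparable s t q := by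
  obtain ⟨φ⟩ := Order.embedding_from_countable_to_dense α ℚ
  obtain ⟨ψ⟩ := Order.embedding_from_countable_to_dense β ℚ
  rw [← app_trans_lt _ _ _ _ φ] at hlt
  rw [← app_trans_lt _ _ _ _ ψ] at hn
  exact tieComparable_of_not_const hs ht (h₀.trans_embedding φ) (h₁.trans_embedding ψ) hlt hn

/-! ### Closure of `ω`-models under continuous functionals -/

/-- A polynomial pairing function. -/
def polyPair (a b : ℕ) : ℕ := (a + b) * (a + b) + a

theorem polyPair_inj {a b c d : ℕ} (h : polyPair a b = polyPair c d) : a = c ∧ b = d := by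
  unfold polyPair at h
  have : a + b = c + d := by
    rcases lt_trichotomy (a + b) (c + d) with hl | hl | hl
    · nlinarith
    · exact hl
    · nlinarith
  rw [this] at h
  omega

/-- The polynomial form makes pairing available as a term, so that table lookups are bounded
formulas. -/
def Tm.polyPair (s t : Tm) : Tm := .add (.mul (.add s t) (.add s t)) s

theorem Tm.val_polyPair (v : ℕ → ℕ) (s t : Tm) :
    (s.polyPair t).val v = DilatorDichotomy.polyPair (s.val v) (t.val v) := rfl

def Tm.num : ℕ → Tm
  | 0 => .zero
  | n + 1 => .add (num n) .one

theorem Tm.val_num (v : ℕ → ℕ) (n : ℕ) : (Tm.num n).val v = n := by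
  induction n with
  | zero => rfl
  | succ n ih => simp [num, val, ih]

def Bdd.imp (φ ψ : Bdd) : Bdd := .or (.neg φ) ψ

theorem Bdd.sat_imp (S : ℕ → Set ℕ) (v : ℕ → ℕ) (φ ψ : Bdd) :
    (φ.imp ψ).Sat S v ↔ (φ.Sat S v → ψ.Sat S v) := by
  simp only [imp, Sat, imp_iff_not_or]

/-- Membership of a quadruple in the set with index `0`. -/
def Bdd.table (k : ℕ) (a b c : Tm) : Bdd :=
  .mem ((Tm.num k).polyPair (a.polyPair (b.polyPair c))) 0

/-- The set that represents a quaternary relation. -/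
def tableSet (T : ℕ → ℕ → ℕ → ℕ → Prop) : Set ℕ :=
  {y | ∃ k a b c, y = polyPair k (polyPair a (polyPair b c)) ∧ T k a b c}

theorem Bdd.sat_table (T : ℕ → ℕ → ℕ → ℕ → Prop) (S : ℕ → Set ℕ) (hS : S 0 = tableSet T)
    (v : ℕ → ℕ) (k : ℕ) (a b c : Tm) :
    (Bdd.table k a b c).Sat S v ↔ T k (a.val v) (b.val v) (c.val v) := by
  simp only [table, Sat, hS, Tm.val_polyPair, Tm.val_num]
  constructor
  · rintro ⟨k', a', b', c', h, hT⟩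
    obtain ⟨rfl, h1⟩ := polyPair_inj h
    obtain ⟨ha, h2⟩ := polyPair_inj h1
    obtain ⟨hb, hc⟩ := polyPair_inj h2
    rwa [ha, hb, hc]
  · exact fun h => ⟨_, _, _, _, rfl, h⟩

/-- The oracles `o` and `o'` have the same parameter and agree below `B`. -/
def Agree {O : Type*} (par : O → ℕ) (F A : O → Set ℕ) (B : ℕ) (o o' : O) : Prop :=
  par o = par o' ∧ ∀ u < B, (u ∈ F o ↔ u ∈ F o') ∧ (u ∈ A o ↔ u ∈ A o')

/-- The number `x` codes the bound `B` and finite sets `P` and `Q`. -/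
def IsInfo (x B : ℕ) (P Q : Finset ℕ) : Prop := x = Nat.pair B (Encodable.encode (P, Q))

theorem IsInfo.unique {x B B' : ℕ} {P Q P' Q' : Finset ℕ} (h : IsInfo x B P Q)
    (h' : IsInfo x B' P' Q') : B = B' ∧ P = P' ∧ Q = Q' := by
  unfold IsInfo at h h'
  rw [h, Nat.pair_eq_pair] at h'
  have := Encodable.encode_injective h'.2
  simp only [Prod.mk.injEq] at this
  exact ⟨h'.1, this⟩

/-- The finite information agrees with the oracles `F` and `A` below `B`. -/
def Fits (B : ℕ) (P Q : Finset ℕ) (F A : Set ℕ) : Prop :=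
  ∀ u < B, (u ∈ F ↔ u ∈ P) ∧ (u ∈ A ↔ u ∈ Q)

/-- The relation that describes which finite information determines membership in the values of
the functional `H`. -/
def infoRel {O : Type*} (par : O → ℕ) (F A : O → Set ℕ) (H : O → Set ℕ) :
    ℕ → ℕ → ℕ → ℕ → Prop
  | 0, p, x, n => ∃ B P Q, IsInfo x B P Q ∧
      ∀ o, par o = p → Fits B P Q (F o) (A o) → n ∈ H o
  | 1, p, x, n => ∃ B P Q, IsInfo x B P Q ∧
      ∀ o, par o = p → Fits B P Q (F o) (A o) → n ∉ H o
  | 2, x, u, _ => ∃ B P Q, IsInfo x B P Q ∧ u < B ∧ u ∈ P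
  | 3, x, u, _ => ∃ B P Q, IsInfo x B P Q ∧ u < B ∧ u ∉ P
  | 4, x, u, _ => ∃ B P Q, IsInfo x B P Q ∧ u < B ∧ u ∈ Q
  | 5, x, u, _ => ∃ B P Q, IsInfo x B P Q ∧ u < B ∧ u ∉ Q
  | _, _, _, _ => False

/-- The information coded by the number with index `0` agrees with the sets `1` and `2`. -/
def fitsFormula : Bdd :=
  .ball (.var 0) (.and
    (.and (.imp (.table 2 (.var 1) (.var 0) .zero) (.mem (.var 0) 1))
      (.imp (.table 3 (.var 1) (.var 0) .zero) (.neg (.mem (.var 0) 1))))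
    (.and (.imp (.table 4 (.var 1) (.var 0) .zero) (.mem (.var 0) 2))
      (.imp (.table 5 (.var 1) (.var 0) .zero) (.neg (.mem (.var 0) 2)))))

theorem sat_fitsFormula {O : Type*} (par : O → ℕ) (F A : O → Set ℕ) (H : O → Set ℕ)
    (S : ℕ → Set ℕ) (hS : S 0 = tableSet (infoRel par F A H)) (v : ℕ → ℕ) {x B : ℕ}
    {P Q : Finset ℕ} (hx : IsInfo x B P Q) :
    fitsFormula.Sat S (push x v) ↔ Fits B P Q (S 1) (S 2) := by
  simp only [fitsFormula, Bdd.Sat, Bdd.sat_imp, Bdd.sat_table _ S hS, Tm.val, push, infoRel]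
  constructor
  · intro h u hu
    -- The bounded quantifier of the formula runs up to the code `x`, which is at least `B`.
    have hux : u < x := hu.trans_le (by rw [hx]; exact Nat.left_le_pair _ _)
    obtain ⟨⟨h2, h3⟩, h4, h5⟩ := h u hux
    refine ⟨⟨fun hm => ?_, fun hm => h2 ⟨_, _, _, hx, hu, hm⟩⟩, ⟨fun hm => ?_,
      fun hm => h4 ⟨_, _, _, hx, hu, hm⟩⟩⟩
    · by_contra hn
      exact h3 ⟨_, _, _, hx, hu, hn⟩ hm
    · by_contra hn
      exact h5 ⟨_, _, _, hx, hu, hn⟩ hm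
  · intro h u _
    refine ⟨⟨?_, ?_⟩, ?_, ?_⟩ <;> rintro ⟨B', P', Q', hx', hu, hm⟩ <;>
      obtain ⟨rfl, rfl, rfl⟩ := hx.unique hx'
    · exact (h u hu).1.2 hm
    · exact fun hn => hm ((h u hu).1.1 hn)
    · exact (h u hu).2.2 hm
    · exact fun hn => hm ((h u hu).2.1 hn)

/-- A continuous functional is computable relative to some table, so that the `ω`-models of `RCA₀`
that contain the table are closed under the functional. -/
theorem exists_table {O : Type*} (par : O → ℕ) (F A : O → Set ℕ) (H : O → Set ℕ)
    (hH : ∀ o n, ∃ B, ∀ o', Agree par F A B o o' → (n ∈ H o ↔ n ∈ H o')) :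
    ∃ Y : Set ℕ, ∀ M, IsOmegaModelRCA0 M → Y ∈ M → ∀ o, F o ∈ M → A o ∈ M → H o ∈ M := by
  classical
  refine ⟨tableSet (infoRel par F A H), fun M hM hY o hF hA => ?_⟩
  let S : ℕ → Set ℕ := fun i =>
    if i = 0 then tableSet (infoRel par F A H) else if i = 1 then F o else A o
  have hS : ∀ i, S i ∈ M := fun i => by
    dsimp only [S]
    split_ifs <;> assumption
  have info : ∀ B, ∃ x P Q, IsInfo x B P Q ∧ Fits B P Q (F o) (A o) := fun B =>
    ⟨_, (Finset.range B).filter (· ∈ F o), (Finset.range B).filter (· ∈ A o), rfl,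
      fun u hu => by simp [hu]⟩
  have agree : ∀ {B P Q o'}, par o' = par o → Fits B P Q (F o) (A o) →
      Fits B P Q (F o') (A o') → Agree par F A B o o' := fun hp h h' =>
    ⟨hp.symm, fun u hu => ⟨(h u hu).1.trans (h' u hu).1.symm, (h u hu).2.trans (h' u hu).2.symm⟩⟩
  -- The `Σ⁰₁` definition: some correct finite information forces `n` into the value.
  have pos : ∀ n, n ∈ H o ↔ ∃ x, (Bdd.and (.table 0 (.var 2) (.var 0) (.var 1)) fitsFormula).Sat S
      (push x (push n fun _ => par o)) := by
    intro n
    constructor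
    · intro hn
      obtain ⟨B, hB⟩ := hH o n
      obtain ⟨x, P, Q, hx, hfit⟩ := info B
      refine ⟨x, (Bdd.sat_table _ S rfl _ _ _ _ _).2 ⟨B, P, Q, hx, fun o' hp hf => ?_⟩,
        (sat_fitsFormula par F A H S rfl _ hx).2 hfit⟩
      exact (hB o' (agree hp hfit hf)).1 hn
    · rintro ⟨x, h1, h2⟩
      obtain ⟨B, P, Q, hx, h⟩ := (Bdd.sat_table _ S rfl _ _ _ _ _).1 h1
      exact h o rfl ((sat_fitsFormula par F A H S rfl _ hx).1 h2)
  -- The `Π⁰₁` definition: no correct finite information forces `n` out of the value.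
  have neg : ∀ n, n ∈ H o ↔
      ∀ x, (Bdd.neg (.and (.table 1 (.var 2) (.var 0) (.var 1)) fitsFormula)).Sat S
        (push x (push n fun _ => par o)) := by
    intro n
    rw [← not_iff_not]
    simp only [Bdd.Sat, not_forall, not_not]
    constructor
    · intro hn
      obtain ⟨B, hB⟩ := hH o n
      obtain ⟨x, P, Q, hx, hfit⟩ := info B
      refine ⟨x, (Bdd.sat_table _ S rfl _ _ _ _ _).2 ⟨B, P, Q, hx, fun o' hp hf => ?_⟩,
        (sat_fitsFormula par F A H S rfl _ hx).2 hfit⟩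
      exact fun hn' => hn ((hB o' (agree hp hfit hf)).2 hn')
    · rintro ⟨x, h1, h2⟩
      obtain ⟨B, P, Q, hx, h⟩ := (Bdd.sat_table _ S rfl _ _ _ _ _).1 h1
      exact h o rfl ((sat_fitsFormula par F A H S rfl _ hx).1 h2)
  have := hM.comprehension _ _ S (fun _ => par o) hS fun n => (pos n).symm.trans (neg n)
  rwa [show H o = _ from Set.ext pos]

/-! ### Descending sequences computed from unstable arguments -/

/-- The argument of importance `q`. -/
noncomputable def Ext.arg {α : Type*} [LinearOrder α] (x : Ext D α) (q : ℕ) (h : q < x.n) : α :=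
  x.enum (x.tr.prio ⟨q, h⟩)

/-- The number that represents the argument of importance `q`. -/
noncomputable def Ext.argNat {α : LO} (q : ℕ) (x : Ext D α) : ℕ :=
  if h : q < x.n then LO.toNat (x.arg q h) else 0

theorem Ext.argNat_of_lt {α : LO} {q : ℕ} {x : Ext D α} (h : q < x.n) :
    x.argNat q = LO.toNat (x.arg q h) := dif_pos h

def Ext.nats {α : LO} (x : Ext D α) : Finset ℕ := x.a.map ⟨LO.toNat, Subtype.val_injective⟩

theorem codeFinset_injective : Function.Injective codeFinset := by
  intro a b h
  have := congrArg List.toFinset (Encodable.encode_injective h)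
  simpa using this

theorem LO.lt_iff {α : LO} (x y : α) : x < y ↔ ¬ α.rel (LO.toNat y) (LO.toNat x) := not_le.symm

/-- The code yields the trace and the set of arguments as numbers, and the order on this finite set
yields their increasing enumeration. Thus the argument of importance `q` depends on finite
information about the order. -/
theorem Ext.argNat_congr {α α' : LO} (q : ℕ) (x : Ext D α) (x' : Ext D α') (hcode : x.code = x'.code)
    (hrel : ∀ u ∈ x.nats, ∀ v ∈ x.nats, α.rel u v ↔ α'.rel u v) : x.argNat q = x'.argNat q := by
  obtain ⟨n, a, card, σ, full⟩ := x
  obtain ⟨n', a', card', σ', full'⟩ := x'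
  simp only [Ext.code, Nat.pair_eq_pair] at hcode
  have ha : a.map ⟨LO.toNat, Subtype.val_injective⟩ = a'.map ⟨LO.toNat, Subtype.val_injective⟩ :=
    codeFinset_injective hcode.2
  have hn : n = n' := by
    rw [← card, ← card', ← Finset.card_map ⟨LO.toNat, Subtype.val_injective⟩, ha, Finset.card_map]
  subst hn
  have hσ : σ = σ' := Subtype.ext hcode.1
  subst hσ
  have hy : ∀ i : Fin n, ∃ e ∈ a', LO.toNat e = LO.toNat (a.orderEmbOfFin card i) := fun i => by
    have := Finset.mem_map_of_mem ⟨LO.toNat, Subtype.val_injective⟩ (a.orderEmbOfFin_mem card i)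
    rw [ha, Finset.mem_map] at this
    exact this
  choose y hya hy using hy
  have hmono : StrictMono y := fun i j hij => by
    have h1 := (a.orderEmbOfFin card).strictMono hij
    rw [LO.lt_iff] at h1 ⊢
    have hr := hrel _ (Finset.mem_map_of_mem ⟨LO.toNat, Subtype.val_injective⟩
      (a.orderEmbOfFin_mem card j)) _ (Finset.mem_map_of_mem ⟨LO.toNat, Subtype.val_injective⟩
      (a.orderEmbOfFin_mem card i))
    rw [hy, hy]
    exact fun h => h1 (hr.2 h)
  have hu := Finset.orderEmbOfFin_unique card' hya hmono
  unfold Ext.argNat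
  by_cases hq : q < n
  · rw [dif_pos hq, dif_pos hq]
    exact (hy _).symm.trans (congrArg LO.toNat (congrFun hu _))
  · rw [dif_neg hq, dif_neg hq]

theorem LO.pair_mem_code (α : LO) (u v : ℕ) :
    Nat.pair u v ∈ α.code ↔ α.rel u v := by
  constructor
  · rintro ⟨x, y, h, e⟩
    obtain ⟨rfl, rfl⟩ := Nat.pair_eq_pair.1 e
    exact h
  · exact fun h => ⟨u, v, h, rfl⟩

/-- A sequence of elements whose arguments of importance `q` do not stabilize after stage `N`. -/
structure Unstable (D : Predilator) where
  q : ℕ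
  N : ℕ
  α : LO
  f : ℕ → Ext D α
  unstable : ∀ j ≥ N, ∃ k > j, ¬ α.rel ((f j).argNat q) ((f k).argNat q)

namespace Unstable

variable (o : Unstable D)

def par : ℕ := Nat.pair o.q o.N

def graph : Set ℕ := {k | ∃ i, k = Nat.pair i (o.f i).code}

/-- The stages at which a smaller argument occurs. -/
noncomputable def stage : ℕ → ℕ
  | 0 => o.N
  | i + 1 => sInf {k | stage i < k ∧ ¬ o.α.rel ((o.f (stage i)).argNat o.q) ((o.f k).argNat o.q)}

/-- The graph of the sequence of arguments at these stages. -/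
def descent : Set ℕ := {k | ∃ i, k = Nat.pair i ((o.f (o.stage i)).argNat o.q)}

theorem stage_succ (h : o.N ≤ o.stage i) : o.stage i < o.stage (i + 1) ∧
    ¬ o.α.rel ((o.f (o.stage i)).argNat o.q) ((o.f (o.stage (i + 1))).argNat o.q) :=
  Nat.sInf_mem (s := {k | o.stage i < k ∧
    ¬ o.α.rel ((o.f (o.stage i)).argNat o.q) ((o.f k).argNat o.q)}) (o.unstable _ h)

theorem le_stage (i : ℕ) : o.N ≤ o.stage i := by
  induction i with
  | zero => exact le_rfl
  | succ i ih => exact ih.trans (o.stage_succ ih).1.le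

/-- The property `p` holds for all sequences that agree with `o` to a sufficient extent. -/
def Near (p : Unstable D → Prop) : Prop :=
  ∃ B, ∀ o', Agree par graph (fun o => o.α.code) B o o' → p o'

variable {o} {p p' : Unstable D → Prop}

theorem Near.mono (h : o.Near p) (hp : ∀ o', p o' → p' o') : o.Near p' :=
  h.imp fun _ hB o' ho => hp _ (hB o' ho)

theorem Near.and (h : o.Near p) (h' : o.Near p') : o.Near fun o' => p o' ∧ p' o' := by
  obtain ⟨B, hB⟩ := h
  obtain ⟨B', hB'⟩ := h'
  exact ⟨max B B', fun o' ho => ⟨hB o' ⟨ho.1, fun u hu => ho.2 u (lt_max_of_lt_left hu)⟩,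
    hB' o' ⟨ho.1, fun u hu => ho.2 u (lt_max_of_lt_right hu)⟩⟩⟩

theorem Near.forall_mem {ι : Type*} (s : Finset ι) {p : ι → Unstable D → Prop}
    (h : ∀ i ∈ s, o.Near (p i)) : o.Near fun o' => ∀ i ∈ s, p i o' := by
  classical
  induction s using Finset.induction_on with
  | empty => exact ⟨0, by simp⟩
  | insert i s _ ih =>
    refine ((h i (by simp)).and (ih fun j hj => h j (by simp [hj]))).mono fun o' ho => ?_
    simpa using ho

variable (o)

theorem near_par : o.Near fun o' => o.q = o'.q ∧ o.N = o'.N :=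
  ⟨0, fun _ ho => Nat.pair_eq_pair.1 ho.1⟩

theorem near_code (j : ℕ) : o.Near fun o' => (o.f j).code = (o'.f j).code := by
  refine ⟨Nat.pair j (o.f j).code + 1, fun o' ho => ?_⟩
  obtain ⟨i, hi⟩ := ((ho.2 _ (Nat.lt_succ_self _)).1).1 ⟨j, rfl⟩
  obtain ⟨rfl, h⟩ := Nat.pair_eq_pair.1 hi
  exact h

theorem near_rel (u v : ℕ) : o.Near fun o' => (o.α.rel u v ↔ o'.α.rel u v) := by
  refine ⟨Nat.pair u v + 1, fun o' ho => ?_⟩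
  have := (ho.2 _ (Nat.lt_succ_self (Nat.pair u v))).2
  rwa [LO.pair_mem_code, LO.pair_mem_code] at this

theorem near_argNat (j : ℕ) : o.Near fun o' => (o.f j).argNat o.q = (o'.f j).argNat o'.q := by
  refine ((o.near_par.and (o.near_code j)).and (Near.forall_mem (o.f j).nats fun u _ =>
    Near.forall_mem (o.f j).nats fun v _ => o.near_rel u v)).mono fun o' ho => ?_
  rw [← ho.1.1.1]
  exact Ext.argNat_congr _ _ _ ho.1.2 ho.2

theorem near_stage (i : ℕ) : o.Near fun o' => o.stage i = o'.stage i := by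
  induction i with
  | zero => exact o.near_par.mono fun o' ho => ho.2
  | succ i ih =>
    -- The next stage is found by a search that ends at `o.stage (i + 1)`, so agreement on the
    -- candidates up to this bound preserves its outcome.
    have h1 := Near.forall_mem (Finset.range (o.stage (i + 1) + 1)) fun k _ =>
      (o.near_argNat k).and (o.near_rel ((o.f (o.stage i)).argNat o.q) ((o.f k).argNat o.q))
    refine ((ih.and (o.near_argNat (o.stage i))).and h1).mono fun o' ⟨⟨hs, hj⟩, hk⟩ => ?_
    have key : ∀ k ≤ o.stage (i + 1), o.stage i < k ∧
        ¬ o.α.rel ((o.f (o.stage i)).argNat o.q) ((o.f k).argNat o.q) ↔ o'.stage i < k ∧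
        ¬ o'.α.rel ((o'.f (o'.stage i)).argNat o'.q) ((o'.f k).argNat o'.q) := fun k hkl => by
      have := hk k (Finset.mem_range.2 (Nat.lt_succ_of_le hkl))
      rw [← hs, ← hj, ← this.1, this.2]
    have hmem := o.stage_succ (o.le_stage i)
    refine le_antisymm (not_lt.1 fun hlt => ?_) (Nat.sInf_le ((key _ le_rfl).1 hmem))
    exact Nat.notMem_of_lt_sInf hlt ((key _ hlt.le).2 (o'.stage_succ (o'.le_stage i)))

theorem near_descent (n : ℕ) : o.Near fun o' => (n ∈ o.descent ↔ n ∈ o'.descent) := by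
  have hmem : ∀ o : Unstable D, n ∈ o.descent ↔
      (o.f (o.stage n.unpair.1)).argNat o.q = n.unpair.2 := fun o => by
    constructor
    · rintro ⟨i, rfl⟩
      simp
    · intro h
      exact ⟨n.unpair.1, by rw [h, Nat.pair_unpair]⟩
  refine ((o.near_stage n.unpair.1).and (o.near_argNat (o.stage n.unpair.1))).mono
    fun o' ⟨h1, h2⟩ => ?_
  rw [hmem, hmem, h2, h1]

end Unstable

/-- Relative to a suitable set, a sequence of elements of `D(α)` in which the arguments of
importance `q` do not stabilize computes a descending sequence in `α`. -/
theorem exists_stabilizing_set (D : Predilator) : ∃ Y : Set ℕ, ∀ M, IsOmegaModelRCA0 M → Y ∈ M →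
    ∀ α : LO, α.code ∈ M → WellFoundedIn M (fun x y : α => x < y) LO.toNat →
    ∀ f : ℕ → Ext D α, {k | ∃ i, k = Nat.pair i (f i).code} ∈ M →
    ∀ (q N : ℕ) (hq : ∀ j ≥ N, q < (f j).n), ∃ (j : ℕ) (hj : N ≤ j),
      ∀ (k : ℕ) (hk : j < k), (f j).arg q (hq j hj) ≤ (f k).arg q (hq k (hj.trans hk.le)) := by
  obtain ⟨Y, hY⟩ := exists_table (Unstable.par (D := D)) Unstable.graph (fun o => o.α.code)
    Unstable.descent fun o n => o.near_descent n
  refine ⟨Y, fun M hM hYM α hα hwf f hf q N hq => ?_⟩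
  by_contra! H
  -- Without a minimum, every stage from `N` on is followed by one with a strictly smaller argument.
  let o : Unstable D := ⟨q, N, α, f, fun j hj => by
    obtain ⟨k, hk, hlt⟩ := H j hj
    rw [LO.lt_iff, ← Ext.argNat_of_lt, ← Ext.argNat_of_lt] at hlt
    exact ⟨k, hk, hlt⟩⟩
  refine hwf ⟨fun i => (f (o.stage i)).arg q (hq _ (o.le_stage i)), fun i => ?_, ?_⟩
  · dsimp only
    rw [LO.lt_iff, ← Ext.argNat_of_lt, ← Ext.argNat_of_lt]
    exact (o.stage_succ (o.le_stage i)).2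
  · have := hY M hM hYM o hf hα
    simp only [Unstable.descent] at this
    convert this using 6 with k i
    exact congrArg _ (Ext.argNat_of_lt _).symm

/-! ### Filling in arguments in `ω · (1 + β)` -/

variable {γ : Type*} [LinearOrder γ]

instance (α : LO) : Countable α := inferInstanceAs (Countable {x : ℕ // α.rel x x})

instance {α β : Type*} [Countable α] [Countable β] : Countable (α ×ₗ β) :=
  inferInstanceAs (Countable (α × β))

instance {α : Type*} [Countable α] : Countable (OmegaMul α) :=
  inferInstanceAs (Countable (WithBot α ×ₗ ℕ))

/-- The element `ω · x + n`. -/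
def OmegaMul.mk (x : WithBot β) (n : ℕ) : OmegaMul β := (toLex (x, n) : WithBot β ×ₗ ℕ)

theorem OmegaMul.mk_lt_mk {x y : WithBot β} {m n : ℕ} :
    OmegaMul.mk x m < OmegaMul.mk y n ↔ x < y ∨ x = y ∧ m < n :=
  Prod.Lex.toLex_lt_toLex (α := WithBot β) (β := ℕ)

theorem OmegaMul.map_mk (f : β ↪o γ) (x : WithBot β) (n : ℕ) :
    OmegaMul.map f (OmegaMul.mk x n) = OmegaMul.mk (WithBot.map f x) n := rfl

/-- The largest of the values that are prescribed up to position `i`. -/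
noncomputable def lowerValue {n l : ℕ} (p : Fin l → Fin n) (y : Fin l → β) (i : Fin n) :
    WithBot β := (Finset.univ.filter fun k => p k ≤ i).sup fun k => (y k : WithBot β)

theorem lowerValue_lt {n l : ℕ} (p : Fin l → Fin n) (y : Fin l → β) {i : Fin n} {x : β}
    (h : ∀ k, p k ≤ i → y k < x) : lowerValue p y i < x :=
  (Finset.sup_lt_iff (WithBot.bot_lt_coe x)).2 fun k hk => by simpa using h k (by simpa using hk)

theorem le_lowerValue {n l : ℕ} (p : Fin l → Fin n) (y : Fin l → β) {i : Fin n} {k : Fin l}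
    (h : p k ≤ i) : (y k : WithBot β) ≤ lowerValue p y i :=
  Finset.le_sup (f := fun k => (y k : WithBot β)) (by simpa using h)

open Classical in
/-- The embedding into `ω · (1 + β)` with prescribed values at some positions, for which the
values at the other positions lie directly above the prescribed ones. -/
noncomputable def fill {n l : ℕ} (p : Fin l → Fin n) (y : Fin l → β)
    (h : ∀ j k, p j < p k ↔ y j < y k) : Fin n ↪o OmegaMul β :=
  OrderEmbedding.ofStrictMono
    -- Prescribed values have offset `0`; the offset `i + 1` puts other positions strictly above
    -- them and in increasing order. Positions below all prescribed ones go into the block of `⊥`.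
    (fun i => OmegaMul.mk (lowerValue p y i) (if ∃ k, p k = i then 0 else i + 1)) (by
      intro i j hij
      rw [OmegaMul.mk_lt_mk]
      have hle : lowerValue p y i ≤ lowerValue p y j := Finset.sup_mono fun k hk => by
        simp only [Finset.mem_filter, Finset.mem_univ, true_and] at hk ⊢
        exact hk.trans hij.le
      refine hle.lt_or_eq.imp_right fun heq => ⟨heq, ?_⟩
      have hj : ¬ ∃ k, p k = j := by
        rintro ⟨k, rfl⟩
        refine absurd heq ((lowerValue_lt p y fun k' hk' => ?_).trans_le
          (le_lowerValue p y le_rfl)).ne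
        exact (h _ _).1 (hk'.trans_lt hij)
      rw [if_neg hj]
      have : (i : ℕ) < j := hij
      split_ifs <;> omega)

theorem fill_apply {n l : ℕ} (p : Fin l → Fin n) (y : Fin l → β)
    (h : ∀ j k, p j < p k ↔ y j < y k) (k : Fin l) : fill p y h (p k) = OmegaMul.mk (y k) 0 := by
  have h1 : lowerValue p y (p k) = y k := by
    refine le_antisymm (Finset.sup_le fun k' hk' => ?_) (le_lowerValue p y le_rfl)
    simp only [Finset.mem_filter, Finset.mem_univ, true_and] at hk'
    exact WithBot.coe_le_coe.2 (not_lt.1 fun hl => hk'.not_gt ((h _ _).2 hl))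
  change OmegaMul.mk _ _ = _
  rw [h1, if_pos ⟨k, rfl⟩]

theorem fill_lt {n l : ℕ} (p : Fin l → Fin n) (y : Fin l → β)
    (h : ∀ j k, p j < p k ↔ y j < y k) {i : Fin n} {x : β} (hx : ∀ k, p k ≤ i → y k < x) (m : ℕ) :
    fill p y h i < OmegaMul.mk x m :=
  OmegaMul.mk_lt_mk.2 (.inl (lowerValue_lt p y hx))

/-- An embedding commutes with finite suprema, and the offsets depend on positions only. This will
be the naturality of the thread embeddings. -/
theorem fill_map {n l : ℕ} (p : Fin l → Fin n) (y : Fin l → β)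
    (h : ∀ j k, p j < p k ↔ y j < y k) (f : β ↪o γ)
    (h' : ∀ j k, p j < p k ↔ f (y j) < f (y k)) :
    fill p (fun k => f (y k)) h' = (fill p y h).trans (OmegaMul.map f) := by
  refine DFunLike.ext _ _ fun i => ?_
  change OmegaMul.mk _ _ = OmegaMul.map f (OmegaMul.mk _ _)
  rw [OmegaMul.map_mk]
  congr 1
  unfold lowerValue
  rw [Finset.apply_sup_eq_sup_comp_of_linearOrder (WithBot.map f)
    (WithBot.monotone_map_iff.2 f.monotone) rfl]
  rfl

/-- The embedding of `ω · (1 + ω)` into `ω²`. -/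
noncomputable def omegaMulNat : OmegaMul ℕ ↪o ℕ ×ₗ ℕ :=
  OrderEmbedding.ofStrictMono
    (fun p : WithBot ℕ ×ₗ ℕ => toLex (((ofLex p).1.recBotCoe 0 Nat.succ : ℕ), (ofLex p).2)) (by
      intro p q h
      have h0 : StrictMono (fun x : WithBot ℕ => (x.recBotCoe 0 Nat.succ : ℕ)) := by
        intro x y hxy
        induction y with
        | bot => exact absurd hxy not_lt_bot
        | coe y =>
          induction x with
          | bot => exact Nat.succ_pos y
          | coe x => exact Nat.succ_lt_succ (WithBot.coe_lt_coe.1 hxy)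
      rw [Prod.Lex.toLex_lt_toLex]
      rcases (Prod.Lex.lt_iff (α := WithBot ℕ) (β := ℕ)).1 h with h | ⟨h, h'⟩
      · exact .inl (h0 h)
      · exact .inr ⟨congrArg (fun x : WithBot ℕ => (x.recBotCoe 0 Nat.succ : ℕ)) h, h'⟩)

/-! ### Stabilization along a descending sequence -/

theorem Ext.arg_lt_arg_iff (x : Ext D α) {j k : ℕ} (hj : j < x.n) (hk : k < x.n) :
    x.tr.prio ⟨j, hj⟩ < x.tr.prio ⟨k, hk⟩ ↔ x.arg j hj < x.arg k hk := x.enum.lt_iff_lt.symm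

/-- A finite family in a linear order has the pattern of a family of natural numbers. -/
theorem exists_nat_pattern {q : ℕ} (z : Fin q → α) :
    ∃ y : Fin q → ℕ, ∀ j k, z j < z k ↔ y j < y k := by
  classical
  let S := Finset.univ.image z
  refine ⟨fun k => (S.orderIsoOfFin rfl).symm ⟨z k, by simp [S]⟩, fun j k => ?_⟩
  rw [Fin.val_fin_lt, OrderIso.lt_iff_lt, Subtype.mk_lt_mk]

/-- In a descending sequence in `D(α)`, all important arguments stabilize if they do so in
the sense that they reach a minimum. -/
theorem exists_stable (hD : WellFounded fun x y : Ext D (ℕ ×ₗ ℕ) => x < y) [Countable α]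
    (f : ℕ → Ext D α) (hf : StrictAnti f)
    (hmin : ∀ (q N : ℕ) (hq : ∀ j ≥ N, q < (f j).n), ∃ (j : ℕ) (hj : N ≤ j),
      ∀ (k : ℕ) (hk : j < k), (f j).arg q (hq j hj) ≤ (f k).arg q (hq k (hj.trans hk.le))) (q : ℕ) :
    ∃ N, ∀ i ≥ N, ∀ j ≥ N, ∀ k < q, ∃ h : TieComparable (f i).tr (f j).tr k,
      (f i).arg k h.hs = (f j).arg k h.ht := by
  induction q with
  | zero => exact ⟨0, by simp⟩
  | succ q ih =>
    obtain ⟨N, hN⟩ := ih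
    have hlen : ∀ i ≥ N, q ≤ (f i).n := fun i hi => by
      rcases q.eq_zero_or_pos with rfl | hq
      · exact Nat.zero_le _
      · obtain ⟨h, -⟩ := hN i hi i hi (q - 1) (by omega)
        have : q - 1 < (f i).n := h.hs
        omega
    have hpre : ∀ i ≥ N, ∀ j ≥ N, Pre (f i).tr (f j).tr q (f i).enum (f j).enum :=
      fun i hi j hj k _ _ hk => (hN i hi j hj k hk).2
    obtain ⟨y, hy⟩ := exists_nat_pattern fun k : Fin q =>
      (f N).arg k (k.2.trans_le (hlen N le_rfl))
    have hpat : ∀ i (hi : N ≤ i) (j k : Fin q),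
        (f i).tr.prio ⟨j, j.2.trans_le (hlen i hi)⟩ < (f i).tr.prio ⟨k, k.2.trans_le (hlen i hi)⟩ ↔
          y j < y k := fun i hi j k => by
      rw [← hy, ← Ext.arg_lt_arg_iff]
      exact (hpre i hi N le_rfl).prio_lt_iff j.2 k.2 _ _ _ _
    -- The `q` stable arguments have the same pattern at all stages, so they can be sent to common
    -- points of `ω²` for all `i`.
    let F : {i // N ≤ i} → Ext D (ℕ ×ₗ ℕ) := fun i =>
      (f i).tr.app ((fill (fun k : Fin q => (f i).tr.prio ⟨k, k.2.trans_le (hlen i i.2)⟩) y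
        (hpat i i.2)).trans omegaMulNat)
    obtain ⟨_, ⟨⟨i, hi⟩, rfl⟩, hmini⟩ := hD.has_min (Set.range F) ⟨_, ⟨N, le_rfl⟩, rfl⟩
    -- For `j > i` we have `f j < f i`, while minimality excludes `F j < F i`. As both pairs share
    -- their `q` most important arguments, the order is not constant.
    have htc : ∀ j > i, TieComparable (f i).tr (f j).tr q := fun j hj => by
      have hNj := hi.trans hj.le
      refine tieComparable_of_countable (hlen i hi) (hlen j hNj) (hpre i hi j hNj) ?_
        (by rw [Ext.app_tr_enum, Ext.app_tr_enum]; exact hf hj)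
        (hmini _ ⟨⟨j, hNj⟩, rfl⟩)
      intro k hs ht hk
      have e1 := fill_apply _ y (hpat i hi) ⟨k, hk⟩
      have e2 := fill_apply _ y (hpat j hNj) ⟨k, hk⟩
      exact congrArg omegaMulNat (e1.trans e2.symm)
    have htc' : ∀ j > i, ∀ k > i, TieComparable (f j).tr (f k).tr q := fun j hj k hk =>
      (htc j hj).trans (htc k hk)
    obtain ⟨j₀, hj₀, hle⟩ := hmin q (i + 1) fun j hj => (htc j hj).ht
    have heq : ∀ k (hk : j₀ ≤ k), (f j₀).arg q (htc j₀ hj₀).ht =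
        (f k).arg q (htc k (hj₀.trans hk)).ht := fun k hk => by
      rcases hk.eq_or_lt with rfl | hlt
      · rfl
      -- A larger argument of importance `q` would make `f k` larger than `f j₀`, although `f`
      -- descends.
      · refine le_antisymm (hle k hlt) (not_lt.1 fun H => ?_)
        have := (htc' j₀ hj₀ k (hj₀.trans hk)).app_lt
          (hpre j₀ (by omega) k (by omega)) H
        rw [Ext.app_tr_enum, Ext.app_tr_enum] at this
        exact this.not_gt (hf hlt)
    refine ⟨j₀, fun a ha b hb k hk => ?_⟩
    rcases (Nat.lt_succ_iff.1 hk).eq_or_lt with rfl | hk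
    · exact ⟨htc' a (by omega) b (by omega), (heq a ha).symm.trans (heq b hb)⟩
    · exact hN a (by omega) b (by omega) k hk

/-! ### Construction of the thread -/

theorem perm_lt_perm_iff (L : LO) (hL : ∀ k, L.rel k k) (n : ℕ) (i j : Fin n) :
    perm L n i < perm L n j ↔ ¬ L.rel j i := by
  rw [← not_le, perm_le_perm_iff L hL]

theorem perm_surjective (L : LO) (hL : ∀ k, L.rel k k) (n : ℕ) :
    Function.Surjective (perm L n) :=
  Finite.injective_iff_surjective.1 fun i j h => Fin.ext (L.antisymm _ _
    ((perm_le_perm_iff L hL n i j).1 h.le) ((perm_le_perm_iff L hL n j i).1 h.ge))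

/-- Trichotomy turns strict monotonicity of the thread maps into the required equivalence. -/
theorem DL.lt_trichotomy {L : LO} (hL : ∀ k, L.rel k k) {α : Type*} [LinearOrder α]
    (σ τ : DL L α) : σ < τ ∨ σ = τ ∨ τ < σ := by
  classical
  by_cases h : ∃ (j : ℕ) (hσ : j < σ.len) (hτ : j < τ.len), σ.arg ⟨j, hσ⟩ ≠ τ.arg ⟨j, hτ⟩
  · obtain ⟨hσ, hτ, hne⟩ := Nat.find_spec h
    have heq : ∀ i (hi : i < Nat.find h), σ.arg ⟨i, hi.trans hσ⟩ = τ.arg ⟨i, hi.trans hτ⟩ :=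
      fun i hi => by
        by_contra hn
        exact Nat.find_min h hi ⟨_, _, hn⟩
    rcases hne.lt_or_gt with hlt | hlt
    · exact .inl (.inl ⟨_, hσ, hτ, hlt, heq⟩)
    · exact .inr (.inr (.inl ⟨_, hτ, hσ, hlt, fun i hi => (heq i hi).symm⟩))
  · push Not at h
    rcases Nat.lt_trichotomy σ.len τ.len with hlt | heq | hlt
    · exact .inl (.inr ⟨hlt, fun i hi => h i _ _⟩)
    · obtain ⟨m, σ⟩ := σ
      obtain ⟨n, τ⟩ := τ
      dsimp only at heq
      subst heq
      refine .inr (.inl (congrArg (DL.mk m) (DFunLike.ext _ _ fun i => ?_)))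
      obtain ⟨k, rfl⟩ := perm_surjective L hL m i
      exact h k k.2 k.2
    · exact .inr (.inr (.inr ⟨hlt, fun i hi => (h i _ _).symm⟩))

/-- A sequence of elements with increasingly many common important arguments yields a thread. -/
theorem exists_isThread {α : Type*} [LinearOrder α] (x : ℕ → Ext D α)
    (hx : ∀ l l' k, k ≤ l → k ≤ l' → ∃ h : TieComparable (x l).tr (x l').tr k,
      (x l).arg k h.hs = (x l').arg k h.ht) : ∃ L : LO, IsThread L D := by
  -- The trace of `x l` has more than `l` arguments; the one of importance `l` is needed when a
  -- sequence of length `l` is compared with a proper extension.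
  have hn : ∀ {l k : ℕ}, k ≤ l → k < (x l).tr.n := fun {l k} hk => (hx l l k hk hk).1.hs
  let z : ℕ → α := fun k => (x k).arg k (hn le_rfl)
  have hz : ∀ {l k : ℕ} (hk : k ≤ l), (x l).arg k (hn hk) = z k := fun {l k} hk =>
    (hx l k k hk le_rfl).2
  -- The thread orders `ℕ` like the stable arguments `z`; antisymmetry holds since two of them occur
  -- at different positions of one common trace.
  let L : LO :=
    { rel := fun i j => z i ≤ z j
      field := fun _ _ _ => ⟨le_rfl, le_rfl⟩
      trans := fun _ _ _ => le_trans
      antisymm := fun i j h h' => by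
        have e := le_antisymm h h'
        rw [← hz (le_max_left i j), ← hz (le_max_right i j)] at e
        exact Fin.mk.inj ((x (max i j)).tr.prio_injective ((x (max i j)).enum.injective e))
      total := fun i j _ _ => le_total _ _ }
  have hL : ∀ k, L.rel k k := fun k => le_rfl
  have hpat : ∀ {β : LO} (ρ : DL L β) (j k : Fin ρ.len),
      (x ρ.len).tr.prio ⟨j, hn j.2.le⟩ < (x ρ.len).tr.prio ⟨k, hn k.2.le⟩ ↔ ρ.arg j < ρ.arg k := by
    intro β ρ j k
    refine (Ext.arg_lt_arg_iff (x ρ.len) (hn j.2.le) (hn k.2.le)).trans ?_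
    rw [hz j.2.le, hz k.2.le]
    refine not_le.symm.trans ((perm_lt_perm_iff L hL _ j k).symm.trans ρ.seq.lt_iff_lt.symm)
  let a : ∀ {β : LO} (ρ : DL L β), Fin (x ρ.len).tr.n ↪o OmegaMul β := fun {β} ρ =>
    fill (fun k : Fin ρ.len => (x ρ.len).tr.prio ⟨k, hn k.2.le⟩) ρ.arg (hpat ρ)
  have ha : ∀ {β : LO} (ρ : DL L β) (k : ℕ) (hk : k < ρ.len),
      a ρ ((x ρ.len).tr.prio ⟨k, hn hk.le⟩) = OmegaMul.mk (ρ.arg ⟨k, hk⟩ : WithBot β) 0 :=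
    fun ρ k hk => fill_apply _ _ (hpat ρ) ⟨k, hk⟩
  have mono : ∀ {β : LO} (ρ τ : DL L β), ρ < τ →
      (x ρ.len).tr.app (a ρ) < (x τ.len).tr.app (a τ) := by
    intro β ρ τ h
    rcases h with ⟨j, hρ, hτ, hlt, heq⟩ | ⟨hlen, heq⟩
    · refine (hx ρ.len τ.len j hρ.le hτ.le).1.app_lt (fun k _ _ hk => ?_) ?_
      · rw [ha ρ k (hk.trans hρ), ha τ k (hk.trans hτ), heq k hk]
      · rw [ha ρ j hρ, ha τ j hτ, OmegaMul.mk_lt_mk]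
        exact .inl (WithBot.coe_lt_coe.2 hlt)
    -- If `τ` extends `ρ`, the argument of importance `ρ.len` decides. For `ρ` it is filled in just
    -- above prescribed values at smaller positions, and by equality of cuts these lie below the
    -- corresponding entry of `τ`.
    · have htc := (hx ρ.len τ.len ρ.len le_rfl hlen.le).1
      refine htc.app_lt (fun k _ _ hk => ?_) ?_
      · rw [ha ρ k hk, ha τ k (hk.trans hlen), heq k hk]
      · rw [ha τ ρ.len hlen]
        refine fill_lt _ _ (hpat ρ) (fun k hk => ?_) 0
        have hne : (x ρ.len).tr.prio ⟨k, hn k.2.le⟩ ≠ (x ρ.len).tr.prio ⟨ρ.len, hn le_rfl⟩ :=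
          fun e => k.2.ne (Fin.mk.inj ((x ρ.len).tr.prio_injective e))
        have := (htc.cut k ρ.len k.2.le le_rfl).1 (lt_of_le_of_ne hk hne)
        rw [show ρ.arg k = _ from heq k k.2]
        exact (hpat τ ⟨k, k.2.trans hlen⟩ ⟨ρ.len, hlen⟩).1 this
  refine ⟨L, hL, fun β ρ => (x ρ.len).tr.app (a ρ), fun β ρ τ => ⟨mono ρ τ, fun h => ?_⟩,
    fun β γ f ρ => ?_⟩
  · rcases DL.lt_trichotomy hL ρ τ with h' | rfl | h'
    · exact h'
    · exact absurd h (lt_irrefl _)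
    · exact absurd h (mono τ ρ h').not_gt
  · refine Eq.trans ?_ (app_map _ _ _).symm
    exact congrArg _ (fill_map _ _ (hpat ρ) f (hpat (ρ.map f)))

end DilatorDichotomy

/-! ### The dichotomy -/

open DilatorDichotomy in
theorem theorem3p5 (D : Predilator)
    (hD : WellFounded fun x y : Ext D (ℕ ×ₗ ℕ) => x < y) :
    RCA0OmegaEntails D.code (IsDilatorIn D) ∨ ∃ L : LO, IsThread L D := by
  by_contra! H
  obtain ⟨hnot, hthread⟩ := H
  obtain ⟨Y, hY⟩ := exists_stabilizing_set D
  refine hnot ⟨Y, fun M hM _ hYM α hα hwf => ?_⟩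
  rintro ⟨f, hf, hfM⟩
  have hst := exists_stable hD f (strictAnti_nat_of_succ_lt hf) (hY M hM hYM α hα hwf f hfM)
  choose N hN using hst
  have hle : ∀ {k l : ℕ}, k ≤ l → N (k + 1) ≤ (Finset.range (l + 1)).sup fun k => N (k + 1) :=
    fun {k l} h => Finset.le_sup (f := fun k => N (k + 1)) (Finset.mem_range.2 (by omega))
  -- Stage `l` is taken beyond the stabilization points for all importances `k ≤ l`, so that any two
  -- chosen elements agree up to the smaller of their indices, inclusively.
  obtain ⟨L, hL⟩ := exists_isThread
    (fun l => f ((Finset.range (l + 1)).sup fun k => N (k + 1))) fun l l' k hk hk' =>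
      hN (k + 1) _ (hle hk) _ (hle hk') k (Nat.lt_succ_self k)
  exact hthread L hL
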